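/- Let $n\ge 0$, let $\mathbb F_q$ be the finite field with $q$ elements and $\overline{\mathbb F}_q$ an algebraic closure. A torus in $\mathrm{GL}_n$ is a Zariski closed connected subgroup of $\mathrm{GL}_n(\overline{\mathbb F}_q)$ that is conjugate to a group of diagonal matrices; it is maximal if it is not contained in any larger torus. Let $\mathcal T_n(\mathbb F_q)$ be the set of maximal tori of $\mathrm{GL}_n$ that are defined over $\mathbb F_q$, i.e. that are the zero locus in $\mathrm{GL}_n(\overline{\mathbb F}_q)$ of a set of polynomials in the matrix entries with coefficients in $\mathbb F_q$. The set $\mathcal T_n(\mathbb F_q)$ is finite. Each $T\in\mathcal T_n(\mathbb F_q)$ preserves exactly $n$ lines $L_1,\dots,L_n$ in $\overline{\mathbb F}_q^{\,n}$ (its eigenlines), and the Frobenius map $(v_1,\dots,v_n)\mapsto(v_1^q,\dots,v_n^q)$ permutes them. Let $\sigma_T\in S_n$ be this permutation with respect to some labelling of the eigenlines; it is determined by $T$ up to conjugacy. Let $R[x_1,\dots,x_n]=\mathbb Q[x_1,\dots,x_n]/I_n$ be the coinvariant algebra, where $I_n$ is the ideal generated by all symmetric polynomials with zero constant term; let $S_n$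 act on it by permuting the variables, and let $R_i[x_1,\dots,x_n]$ be its homogeneous part of degree $i$, which is zero for all but finitely many $i$. Then for every class function $\chi$ on $S_n$, with values in a field of characteristic zero, $$\sum_{T\in\mathcal T_n(\mathbb F_q)}\chi(\sigma_T)=\sum_{i\ge 0}q^{\,n^2-n-i}\,\langle\chi,R_i[x_1,\dots,x_n]\rangle,$$ where $\langle\chi,V\rangle=\frac1{n!}\sum_{\sigma\in S_n}\chi(\sigma)\,\mathrm{tr}(\sigma\mid V)$ is the standard inner product of $\chi$ with the character of the rational representation $V$. -/

import Mathlib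

open MvPolynomial

noncomputable section

namespace MaximalTori

/-! ### Algebraic subgroups and tori of the general linear group -/

section Tori

variable {n : ℕ} {K : Type*} [Field K]

/-- The value of a polynomial in the `n ^ 2` matrix entries, with coefficients in a subfield `F`
of `K`, at an invertible matrix over `K`. -/
def evalEntries {F : Type*} [Field F] [Algebra F K] (g : GL (Fin n) K)
    (p : MvPolynomial (Fin n × Fin n) F) : K :=
  aeval (fun ij : Fin n × Fin n => (g : Matrix (Fin n) (Fin n) K) ij.1 ij.2) p

/-- The Zariski topology on `GL_n(K)`: it is generated by the sets where a polynomial in the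
matrix entries does not vanish. -/
abbrev zariski (n : ℕ) (K : Type*) [Field K] : TopologicalSpace (GL (Fin n) K) :=
  TopologicalSpace.generateFrom
    {U | ∃ p : MvPolynomial (Fin n × Fin n) K, U = {g | evalEntries g p ≠ 0}}

/-- A torus in `GL_n` over an algebraically closed field `K`: a Zariski closed, connected subgroup
of `GL_n(K)` which is conjugate to a group of diagonal matrices. -/
structure IsTorus (T : Subgroup (GL (Fin n) K)) : Prop where
  isClosed : @IsClosed _ (zariski n K) (T : Set (GL (Fin n) K))
  isConnected : @IsConnected _ (zariski n K) (T : Set (GL (Fin n) K))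
  diagonalizable : ∃ g : GL (Fin n) K, ∀ t ∈ T,
    ((g⁻¹ * t * g : GL (Fin n) K) : Matrix (Fin n) (Fin n) K).IsDiag

/-- A maximal torus of `GL_n`: a torus that is not contained in any larger torus. -/
def IsMaximalTorus (T : Subgroup (GL (Fin n) K)) : Prop :=
  Maximal (fun S : Subgroup (GL (Fin n) K) => IsTorus S) T

/-- `T` is the zero locus in `GL_n(K)` of polynomials with coefficients in `F`. For a perfect
field `F` (such as a finite field) with algebraic closure `K`, this says that `T` is an algebraic
subgroup of `GL_n` defined over `F`. -/
def IsDefinedOver (F : Type*) [Field F] [Algebra F K] (T : Subgroup (GL (Fin n) K)) : Prop :=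
  ∃ S : Set (MvPolynomial (Fin n × Fin n) F),
    ∀ g : GL (Fin n) K, g ∈ T ↔ ∀ p ∈ S, evalEntries g p = 0

/-- The lines in `K ^ n` preserved by every element of `T`. -/
def eigenlines (T : Subgroup (GL (Fin n) K)) : Set (Submodule K (Fin n → K)) :=
  {L | Module.finrank K L = 1 ∧
    ∀ g ∈ T, ∀ v ∈ L, Matrix.mulVec (g : Matrix (Fin n) (Fin n) K) v ∈ L}

/-- The image of a subspace of `K ^ n` under the `q`-Frobenius, raising all coordinates to the
`q`-th power. -/
def frobeniusImage (q : ℕ) (L : Submodule K (Fin n → K)) : Submodule K (Fin n → K) :=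
  Submodule.span K ((fun v : Fin n → K => fun i => v i ^ q) '' (L : Set (Fin n → K)))

/-- `σ` is the permutation of the eigenlines of `T` induced by the `q`-Frobenius, for some
labelling of the eigenlines by `1, …, n` (without repetition). -/
def IsFrobeniusPermutation (q : ℕ) (T : Subgroup (GL (Fin n) K))
    (σ : Equiv.Perm (Fin n)) : Prop :=
  ∃ L : Fin n → Submodule K (Fin n → K), Function.Injective L ∧ Set.range L = eigenlines T ∧
    ∀ i, frobeniusImage q (L i) = L (σ i)

end Tori

/-- The maximal tori of `GL_n` defined over `F`. -/
def MaxTori (n : ℕ) (F : Type*) [Field F] : Type _ :=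
  {T : Subgroup (GL (Fin n) (AlgebraicClosure F)) // IsMaximalTorus T ∧ IsDefinedOver F T}

/-! ### The coinvariant algebra -/

/-- The ideal of `ℚ[x_1, …, x_n]` generated by the symmetric polynomials with zero constant
term. -/
def coinvariantIdeal (n : ℕ) : Ideal (MvPolynomial (Fin n) ℚ) :=
  Ideal.span {p | p.IsSymmetric ∧ constantCoeff p = 0}

/-- The coinvariant algebra `R[x_1, …, x_n]`. -/
abbrev CoinvariantAlgebra (n : ℕ) : Type :=
  MvPolynomial (Fin n) ℚ ⧸ coinvariantIdeal n

theorem coinvariantIdeal_le_comap (n : ℕ) (σ : Equiv.Perm (Fin n)) :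
    coinvariantIdeal n ≤ (coinvariantIdeal n).comap (rename (R := ℚ) σ) := by
  refine Ideal.span_le.2 fun p hp => ?_
  have h : rename (R := ℚ) σ p = p := hp.1 σ
  simp only [SetLike.mem_coe, Ideal.mem_comap, h]
  exact Ideal.subset_span hp

/-- The action of `S_n` on the coinvariant algebra induced by permuting the variables,
`x_i ↦ x_{σ i}`. -/
def coinvariantRep (n : ℕ) : Representation ℚ (Equiv.Perm (Fin n)) (CoinvariantAlgebra n) where
  toFun σ := (Ideal.quotientMapₐ (coinvariantIdeal n) (rename (R := ℚ) σ)
    (coinvariantIdeal_le_comap n σ)).toLinearMap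
  map_one' := by
    refine LinearMap.ext fun x => ?_
    obtain ⟨p, rfl⟩ := Ideal.Quotient.mk_surjective x
    simp [Equiv.Perm.coe_one]
  map_mul' σ τ := by
    refine LinearMap.ext fun x => ?_
    obtain ⟨p, rfl⟩ := Ideal.Quotient.mk_surjective x
    simp [rename_rename, Equiv.Perm.coe_mul]

/-- The degree `i` part `R_i[x_1, …, x_n]` of the coinvariant algebra: the image of the
homogeneous polynomials of degree `i`. -/
def coinvariantPart (n i : ℕ) : Submodule ℚ (CoinvariantAlgebra n) :=
  (homogeneousSubmodule (Fin n) ℚ i).map (Ideal.Quotient.mkₐ ℚ (coinvariantIdeal n)).toLinearMap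

theorem coinvariantPart_le_comap (n i : ℕ) (σ : Equiv.Perm (Fin n)) :
    coinvariantPart n i ≤ (coinvariantPart n i).comap (coinvariantRep n σ) := by
  rintro _ ⟨p, hp, rfl⟩
  exact ⟨rename σ p, IsHomogeneous.rename_isHomogeneous hp, by simp [coinvariantRep]⟩

/-- The representation of `S_n` on `R_i[x_1, …, x_n]`. -/
def coinvariantPartRep (n i : ℕ) :
    Representation ℚ (Equiv.Perm (Fin n)) (coinvariantPart n i) :=
  (coinvariantRep n).subrepresentation (coinvariantPart n i) (coinvariantPart_le_comap n i)

/-- The standard inner product of a class function on `S_n` with the character of a rational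
representation of `S_n` (whose values are rational, so that no complex conjugation is needed). -/
def innerChar {n : ℕ} {k : Type*} [Field k] [CharZero k] (χ : Equiv.Perm (Fin n) → k)
    {V : Type*} [AddCommGroup V] [Module ℚ V] (ρ : Representation ℚ (Equiv.Perm (Fin n)) V) : k :=
  (n.factorial : k)⁻¹ * ∑ σ : Equiv.Perm (Fin n), χ σ * ((ρ.character σ : ℚ) : k)

end MaximalTori

end

/-! For w in S_n let N_w be the number of labelled frames (L_1, …, L_n), that is, families of lines
spanned by the members of a basis, such that Frobenius sends L_i to L_{w(i)}. Maximal tori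
correspond to unlabelled frames through their eigenlines (`isMaximalTorus_iff`,
`eigenlines_frameTorus`), and being defined over F_q amounts to Frobenius permuting these lines
(`frameTorus_frobGL`, `isDefinedOver_frameTorus`). A torus has n! labellings and relabelling
conjugates its permutation, so ∑_w χ(w) N_w = n! ∑_T χ(σ_T) (`sum_frobFrames`). It remains to prove
N_w = q^(n²-n) ∑_i q^(-i) tr(w | R_i) for each w.

Counting side. The bases with Frob(g_i) = g_{w(i)} form a torsor under GL_n(F_q) (`card_frobBases`);
they exist by Dedekind's independence of characters (`span_equivariant`). Every permuted frame lifts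
to such a basis by solving a twisted Lang equation for scalars (`exists_units_twisted`), and the
lifts form a torsor under a group of order ∏_c (q^|c| - 1), with c running over the orbits of w.
Hence N_w ∏_c (q^|c| - 1) = |GL_n(F_q)| (`card_frobFrames_mul`).

Algebraic side. The polynomial ring is free over the symmetric polynomials on the monomials x^a with
a_j ≤ j (indices from 0): a tower of monic equations shows that they span, and a count in each
degree shows that they are independent. The trace of w on polynomials of degree i, computed in this
basis and in the basis of monomials, gives (∑_i tr(w | R_i) t^i) ∏_c (1 - t^|c|) = ∏_{j=1}^n (1 -
t^j) (`graded_character_mul`). Setting t = 1/q and using |GL_n(F_q)| = q^(n²) ∏_j (1 - q^(-j)) gives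
the formula for N_w. -/

namespace MaximalTori

noncomputable section

/-! ### Orbits of a permutation and equivariant families -/

section Orbits

variable {ι : Type*}

/-- The set of orbits of a permutation, fixed points included. -/
abbrev Orbits (w : Equiv.Perm ι) : Type _ :=
  Quotient (Equiv.Perm.SameCycle.setoid w)

/-- The length of an orbit. -/
def orbitLength {w : Equiv.Perm ι} (c : Orbits w) : ℕ :=
  Function.minimalPeriod w c.out

variable (w : Equiv.Perm ι)

theorem mk_iterate (k : ℕ) (i : ι) :
    Quotient.mk (Equiv.Perm.SameCycle.setoid w) (w^[k] i) =
      Quotient.mk (Equiv.Perm.SameCycle.setoid w) i := by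
  refine Quotient.sound ?_
  change w.SameCycle _ _
  rw [← Equiv.Perm.coe_pow, Equiv.Perm.sameCycle_pow_left]

theorem mk_apply (i : ι) :
    Quotient.mk (Equiv.Perm.SameCycle.setoid w) (w i) =
      Quotient.mk (Equiv.Perm.SameCycle.setoid w) i :=
  mk_iterate w 1 i

variable {α : Type*} (f : ι → α → α)

/-- The map `(i, x) ↦ (w i, f i x)`. -/
def skewMap (p : ι × α) : ι × α := (w p.1, f p.1 p.2)

theorem skewMap_iterate_fst (k : ℕ) (p : ι × α) : ((skewMap w f)^[k] p).1 = w^[k] p.1 := by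
  induction k with
  | zero => rfl
  | succ k ih => rw [Function.iterate_succ_apply', Function.iterate_succ_apply', ← ih]; rfl

/-- The families `r` with `r (w i) = f i (r i)`. -/
def Equivariant : Type _ := {r : ι → α // ∀ i, r (w i) = f i (r i)}

/-- The composite of the maps `f i` along an orbit. -/
def orbitMap (c : Orbits w) (x : α) : α := ((skewMap w f)^[orbitLength c] (c.out, x)).2

theorem skewMap_iterate_equivariant (r : Equivariant w f) (i : ι) (k : ℕ) :
    (skewMap w f)^[k] (i, r.1 i) = (w^[k] i, r.1 (w^[k] i)) := by
  induction k with
  | zero => rfl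
  | succ k ih =>
    rw [Function.iterate_succ_apply', ih, Function.iterate_succ_apply', skewMap, r.2]

theorem skewMap_iterate_const (g : α → α) (k : ℕ) (p : ι × α) :
    (skewMap w (fun _ => g))^[k] p = (w^[k] p.1, g^[k] p.2) := by
  induction k with
  | zero => rfl
  | succ k ih =>
    rw [Function.iterate_succ_apply', ih, Function.iterate_succ_apply',
      Function.iterate_succ_apply', skewMap]

theorem orbitMap_const (g : α → α) (c : Orbits w) : orbitMap w (fun _ => g) c = g^[orbitLength c] :=
  funext fun x => by rw [orbitMap, skewMap_iterate_const]

variable [Finite ι]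

instance : Finite (Orbits w) := Quotient.finite _

instance : Fintype (Orbits w) := Fintype.ofFinite _

theorem mem_periodicPts_perm (i : ι) : i ∈ Function.periodicPts w :=
  w.injective.mem_periodicPts i

theorem orbitLength_pos {w : Equiv.Perm ι} (c : Orbits w) : 0 < orbitLength c :=
  Function.minimalPeriod_pos_of_mem_periodicPts (mem_periodicPts_perm w _)

theorem exists_iterate_out (i : ι) :
    ∃ k : ℕ, w^[k] (Quotient.mk (Equiv.Perm.SameCycle.setoid w) i).out = i := by
  have h : w.SameCycle (Quotient.mk (Equiv.Perm.SameCycle.setoid w) i).out i :=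
    Quotient.exact (s := Equiv.Perm.SameCycle.setoid w) (Quotient.out_eq _)
  obtain ⟨k, hk⟩ := h.exists_nat_pow_eq
  exact ⟨k, by rw [← Equiv.Perm.coe_pow, hk]⟩

theorem mod_eq_of_iterate_eq {i : ι} {a b : ℕ} (h : w^[a] i = w^[b] i) :
    a % Function.minimalPeriod w i = b % Function.minimalPeriod w i := by
  have hpos := Function.minimalPeriod_pos_of_mem_periodicPts (mem_periodicPts_perm w i)
  refine Function.iterate_injOn_Iio_minimalPeriod (f := w) (x := i)
    (Nat.mod_lt _ hpos) (Nat.mod_lt _ hpos) ?_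
  simpa only [Function.iterate_mod_minimalPeriod_eq] using h

/-- The elements of an orbit, listed starting from the chosen one. -/
def orbitEquiv (c : Orbits w) :
    Fin (orbitLength c) ≃ {i : ι // Quotient.mk (Equiv.Perm.SameCycle.setoid w) i = c} :=
  Equiv.ofBijective (fun k => ⟨w^[k] c.out, by rw [mk_iterate, Quotient.out_eq]⟩) <| by
    constructor
    · intro a b h
      have := mod_eq_of_iterate_eq w (Subtype.ext_iff.1 h)
      have ha := a.2
      have hb := b.2
      unfold orbitLength at ha hb
      rw [Nat.mod_eq_of_lt ha, Nat.mod_eq_of_lt hb] at this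
      exact Fin.ext this
    · rintro ⟨i, rfl⟩
      obtain ⟨k, hk⟩ := exists_iterate_out w i
      refine ⟨⟨k % orbitLength _, Nat.mod_lt _ (orbitLength_pos _)⟩, Subtype.ext ?_⟩
      simp only [orbitLength]
      rw [Function.iterate_mod_minimalPeriod_eq, hk]

/-- An equivariant family is determined by arbitrary fixed points of the composites along the
orbits. -/
def equivariantEquiv : Equivariant w f ≃ ∀ c : Orbits w, {x : α // orbitMap w f c x = x} where
  toFun r c := ⟨r.1 c.out, by
    rw [orbitMap, skewMap_iterate_equivariant, orbitLength, Function.iterate_minimalPeriod]⟩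
  invFun x := ⟨fun i => ((skewMap w f)^[(exists_iterate_out w i).choose]
      ((Quotient.mk (Equiv.Perm.SameCycle.setoid w) i).out, (x (Quotient.mk _ i)).1)).2, by
    intro i
    have h1 := (exists_iterate_out w i).choose_spec
    have h2 := (exists_iterate_out w (w i)).choose_spec
    beta_reduce
    generalize (exists_iterate_out w i).choose = a at h1 ⊢
    generalize (exists_iterate_out w (w i)).choose = b at h2 ⊢
    rw [mk_apply] at h2 ⊢
    generalize Quotient.mk (Equiv.Perm.SameCycle.setoid w) i = c at h1 h2 ⊢
    have hper : Function.IsPeriodicPt (skewMap w f) (orbitLength c) (c.out, (x c).1) := by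
      refine Prod.ext ?_ (x c).2
      rw [skewMap_iterate_fst, orbitLength, Function.iterate_minimalPeriod]
    -- Both b and a + 1 steps lead to the same index. They agree modulo the orbit length, and the
    -- starting pair is periodic with that period because `x c` is fixed by the composite.
    have hab : b % orbitLength c = (a + 1) % orbitLength c :=
      mod_eq_of_iterate_eq w (by rw [h2, Function.iterate_succ_apply', h1])
    rw [← hper.iterate_mod_apply, hab, hper.iterate_mod_apply, Function.iterate_succ_apply']
    have h3 := skewMap_iterate_fst w f a (c.out, (x c).1)
    rw [h1] at h3
    rw [skewMap, h3]⟩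
  left_inv r := by
    refine Subtype.ext (funext fun i => ?_)
    simp only
    rw [skewMap_iterate_equivariant]
    simp only
    rw [(exists_iterate_out w i).choose_spec]
  right_inv x := by
    refine funext fun c => Subtype.ext ?_
    simp only
    have h1 := (exists_iterate_out w c.out).choose_spec
    generalize (exists_iterate_out w c.out).choose = a at h1 ⊢
    rw [Quotient.out_eq] at h1 ⊢
    have hper : Function.IsPeriodicPt (skewMap w f) (orbitLength c) (c.out, (x c).1) := by
      refine Prod.ext ?_ (x c).2
      rw [skewMap_iterate_fst, orbitLength, Function.iterate_minimalPeriod]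
    have ha : a % orbitLength c = 0 % orbitLength c := mod_eq_of_iterate_eq w h1
    rw [← hper.iterate_mod_apply, ha, Nat.zero_mod]
    rfl

theorem exists_equivariant {w : Equiv.Perm ι} {f : ι → α → α} (x : Orbits w → α)
    (hx : ∀ c, orbitMap w f c (x c) = x c) :
    ∃ r : ι → α, (∀ i, r (w i) = f i (r i)) ∧ ∀ c : Orbits w, r c.out = x c := by
  refine ⟨((equivariantEquiv w f).symm fun c => ⟨x c, hx c⟩).1,
    ((equivariantEquiv w f).symm fun c => ⟨x c, hx c⟩).2, fun c => ?_⟩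
  have := congrFun ((equivariantEquiv w f).apply_symm_apply fun c => ⟨x c, hx c⟩) c
  exact Subtype.ext_iff.1 this

end Orbits

section OrbitSums

variable {ι : Type*} [Fintype ι] (w : Equiv.Perm ι)

theorem sum_orbits {M : Type*} [AddCommMonoid M] (f : Orbits w → M) :
    ∑ i, f (Quotient.mk _ i) = ∑ c : Orbits w, orbitLength c • f c := by
  classical
  rw [← Finset.sum_fiberwise (Finset.univ) (fun i => Quotient.mk (Equiv.Perm.SameCycle.setoid w) i)]
  refine Finset.sum_congr rfl fun c _ => ?_
  have : ∀ i ∈ Finset.univ.filter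
      (fun i => Quotient.mk (Equiv.Perm.SameCycle.setoid w) i = c), f (Quotient.mk _ i) = f c := by
    intro i hi
    rw [(Finset.mem_filter.1 hi).2]
  rw [Finset.sum_congr rfl this, Finset.sum_const]
  congr 1
  rw [← Fintype.card_subtype, ← Fintype.card_congr (orbitEquiv w c), Fintype.card_fin]

theorem sum_orbitLength : ∑ c : Orbits w, orbitLength c = Fintype.card ι := by
  simpa using (sum_orbits w (fun _ => (1 : ℕ))).symm

end OrbitSums

/-! ### Weighted compositions -/

section Series

theorem geometric_mul_one_sub {d : ℕ} (hd : 0 < d) :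
    (PowerSeries.mk fun m => if d ∣ m then (1 : ℚ) else 0) * (1 - PowerSeries.X ^ d) = 1 := by
  ext m
  rw [mul_sub, mul_one, map_sub, PowerSeries.coeff_mul_X_pow', PowerSeries.coeff_mk,
    PowerSeries.coeff_one]
  by_cases hm : d ≤ m
  · have : m ≠ 0 := by omega
    simp [hm, this, PowerSeries.coeff_mk, Nat.dvd_sub_self_right]
    by_cases h : d = m
    · simp [h]
    · simp [show ¬ m ≤ d by omega]
  · rcases Nat.eq_zero_or_pos m with rfl | h0
    · simp [hm]
    · have : ¬ d ∣ m := fun h => hm (Nat.le_of_dvd h0 h)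
      simp [hm, this, h0.ne']

/-- The families `b` of natural numbers with `∑ d i * b i = m`. -/
def Weighted {ι : Type*} [Fintype ι] (d : ι → ℕ) (m : ℕ) : Type _ :=
  {b : ι → ℕ // ∑ i, d i * b i = m}

variable {ι : Type*} [Fintype ι] {d : ι → ℕ}

theorem finite_weighted (hd : ∀ i, 0 < d i) (m : ℕ) : Finite (Weighted d m) := by
  refine Finite.of_injective (β := ι → Fin (m + 1)) (fun b i => ⟨b.1 i, ?_⟩) ?_
  · have h1 : d i * b.1 i ≤ m := by
      conv_rhs => rw [← b.2]
      exact Finset.single_le_sum (f := fun i => d i * b.1 i) (fun _ _ => Nat.zero_le _)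
        (Finset.mem_univ i)
    have h2 := Nat.le_mul_of_pos_left (b.1 i) (hd i)
    omega
  · intro a b h
    refine Subtype.ext (funext fun i => ?_)
    simpa using congrFun h i

/-- The series is the product of the geometric series 1/(1 - X^(d i)). It is used with d the orbit
lengths of w and with d = 1, …, n. -/
theorem weighted_series (hd : ∀ i, 0 < d i) :
    (PowerSeries.mk fun m => (Nat.card (Weighted d m) : ℚ)) *
      ∏ i, (1 - PowerSeries.X ^ d i : PowerSeries ℚ) = 1 := by
  classical
  have key : (PowerSeries.mk fun m => (Nat.card (Weighted d m) : ℚ)) =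
      ∏ i, PowerSeries.mk fun m => if d i ∣ m then (1 : ℚ) else 0 := by
    ext m
    rw [PowerSeries.coeff_mk, PowerSeries.coeff_prod]
    simp only [PowerSeries.coeff_mk]
    have hprod : ∀ l : ι →₀ ℕ, (∏ i, if d i ∣ l i then (1 : ℚ) else 0) =
        if ∀ i, d i ∣ l i then 1 else 0 := by
      intro l
      rw [Finset.prod_ite_zero]
      simp
    rw [Finset.sum_congr rfl fun l _ => hprod l, Finset.sum_ite, Finset.sum_const_zero, add_zero]
    simp only [Finset.sum_const, nsmul_eq_mul, mul_one]
    congr 1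
    rw [← Nat.card_eq_finsetCard]
    refine Nat.card_congr (Equiv.ofBijective (fun b => ⟨Finsupp.equivFunOnFinite.symm
      fun i => d i * b.1 i, ?_⟩) ⟨?_, ?_⟩)
    · simp [Finset.mem_finsuppAntidiag, b.2]
    · intro a b h
      refine Subtype.ext (funext fun i => ?_)
      have := DFunLike.congr_fun (Subtype.ext_iff.1 h) i
      exact Nat.eq_of_mul_eq_mul_left (hd i) (by simpa using this)
    · rintro ⟨l, hl⟩
      simp only [Finset.mem_filter, Finset.mem_finsuppAntidiag] at hl
      refine ⟨⟨fun i => l i / d i, ?_⟩, Subtype.ext (Finsupp.ext fun i => ?_)⟩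
      · rw [← hl.1.1]
        exact Finset.sum_congr rfl fun i _ => Nat.mul_div_cancel' (hl.2 i)
      · simpa using Nat.mul_div_cancel' (hl.2 i)
  rw [key, ← Finset.prod_mul_distrib]
  exact Finset.prod_eq_one fun i _ => geometric_mul_one_sub (hd i)

end Series

/-! ### Traces on graded pieces -/

section Trace

variable {k V ι : Type*} [Field k] [AddCommGroup V] [Module k V]

/-- If `U` is spanned by the members of a basis indexed by a finite set `s`, the trace on `U` of an
endomorphism preserving `U` is the sum of its diagonal entries over `s`. -/
theorem trace_restrict_span (E : Module.Basis ι k V) (s : Set ι) [Fintype s] {U : Submodule k V}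
    (hU : U = Submodule.span k (E '' s)) (f : V →ₗ[k] V) (hf : ∀ v ∈ U, f v ∈ U) :
    LinearMap.trace k U (f.restrict hf) = ∑ x : s, E.repr (f (E x)) x := by
  classical
  subst hU
  have hli : LinearIndependent k (fun x : s => E x) := E.linearIndependent.comp _
    Subtype.val_injective
  have himg : E '' s = Set.range fun x : s => E x := by
    rw [Set.image_eq_range]
  let B : Module.Basis s k (Submodule.span k (E '' s)) :=
    (Module.Basis.span hli).map (LinearEquiv.ofEq _ _ (by rw [himg]))
  have hB : ∀ x : s, (B x : V) = E x := fun x => by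
    simp [B, Module.Basis.span_apply]
  have hrepr : ∀ (v : Submodule.span k (E '' s)) (x : s), B.repr v x = E.repr v x := by
    intro v x
    have h1 : (v : V) = ∑ y : s, B.repr v y • E y := by
      conv_lhs => rw [← B.sum_repr v]
      simp only [Submodule.coe_sum, Submodule.coe_smul, hB]
    conv_rhs => rw [h1]
    simp only [map_sum, map_smul, Module.Basis.repr_self, Finsupp.coe_finsetSum, Finset.sum_apply,
      Finsupp.smul_apply, smul_eq_mul, Finsupp.single_apply]
    rw [Finset.sum_eq_single x]
    · simp
    · intro y _ hy
      rw [if_neg (fun h => hy (Subtype.ext h)), mul_zero]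
    · simp
  rw [LinearMap.trace_eq_matrix_trace k B, Matrix.trace]
  refine Finset.sum_congr rfl fun x _ => ?_
  rw [Matrix.diag_apply, LinearMap.toMatrix_apply, hrepr, LinearMap.coe_restrict_apply, hB]

end Trace

/-! ### The Artin basis of the polynomial ring over the symmetric polynomials -/

section Artin

variable {n : ℕ}

/-- The exponents `a` with `a j ≤ j`. -/
abbrev Staircase (n : ℕ) : Type := ∀ j : Fin n, Fin ((j : ℕ) + 1)

/-- The product of powers of elementary symmetric polynomials with exponents `b`. -/
def esymmMonomial (b : Fin n → ℕ) : MvPolynomial (Fin n) ℚ :=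
  ∏ j : Fin n, esymm (Fin n) ℚ ((j : ℕ) + 1) ^ b j

/-- The products of a monomial under the staircase with a monomial in the elementary symmetric
polynomials. -/
def artinMonomial (x : Staircase n × (Fin n → ℕ)) : MvPolynomial (Fin n) ℚ :=
  (∏ j : Fin n, X j ^ (x.1 j : ℕ)) * esymmMonomial x.2

/-- The total degree of a staircase exponent. -/
def stairDegree (a : Staircase n) : ℕ := ∑ j, (a j : ℕ)

/-- The degree of `esymmMonomial b`. -/
def esymmDegree (b : Fin n → ℕ) : ℕ := ∑ j : Fin n, ((j : ℕ) + 1) * b j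

theorem esymmMonomial_zero : esymmMonomial (0 : Fin n → ℕ) = 1 := by
  simp [esymmMonomial]

theorem esymmMonomial_add (b c : Fin n → ℕ) :
    esymmMonomial (b + c) = esymmMonomial b * esymmMonomial c := by
  simp [esymmMonomial, pow_add, Finset.prod_mul_distrib]

theorem artinMonomial_mul (a : Staircase n) (b c : Fin n → ℕ) :
    artinMonomial (a, b) * esymmMonomial c = artinMonomial (a, b + c) := by
  simp only [artinMonomial, esymmMonomial_add, mul_assoc]

theorem isSymmetric_esymmMonomial (b : Fin n → ℕ) : (esymmMonomial b).IsSymmetric := by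
  rw [← mem_symmetricSubalgebra]
  exact Subalgebra.prod_mem _ fun j _ => Subalgebra.pow_mem _ (esymm_isSymmetric _ _ _) _

theorem isHomogeneous_esymm (k : ℕ) : (esymm (Fin n) ℚ k).IsHomogeneous k := by
  refine IsHomogeneous.sum _ _ _ fun t ht => ?_
  have h := IsHomogeneous.prod t (fun i => (X i : MvPolynomial (Fin n) ℚ)) (fun _ => 1)
    fun i _ => isHomogeneous_X _ i
  rwa [Finset.sum_const, smul_eq_mul, mul_one, (Finset.mem_powersetCard.1 ht).2] at h

theorem isHomogeneous_esymmMonomial (b : Fin n → ℕ) :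
    (esymmMonomial b).IsHomogeneous (esymmDegree b) :=
  IsHomogeneous.prod _ _ _ fun _ _ => (isHomogeneous_esymm _).pow _

theorem isHomogeneous_artinMonomial (x : Staircase n × (Fin n → ℕ)) :
    (artinMonomial x).IsHomogeneous (stairDegree x.1 + esymmDegree x.2) :=
  (IsHomogeneous.prod _ _ _ fun _ _ => isHomogeneous_X_pow _ _).mul (isHomogeneous_esymmMonomial _)

theorem constantCoeff_esymmMonomial {b : Fin n → ℕ} (hb : b ≠ 0) :
    constantCoeff (esymmMonomial b) = 0 := by
  obtain ⟨j, hj⟩ := Function.ne_iff.1 hb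
  have h0 : esymmDegree b ≠ 0 := by
    have : ((j : ℕ) + 1) * b j ≤ esymmDegree b := Finset.single_le_sum
      (f := fun j : Fin n => ((j : ℕ) + 1) * b j) (fun _ _ => Nat.zero_le _) (Finset.mem_univ j)
    have h1 : 0 < ((j : ℕ) + 1) * b j := Nat.mul_pos (Nat.succ_pos _) (Nat.pos_of_ne_zero hj)
    omega
  rw [constantCoeff_eq]
  exact (isHomogeneous_esymmMonomial b).coeff_eq_zero (by simpa using h0.symm)

/-- The algebra generated by the elementary symmetric polynomials and the variables from the `k`-th
onwards. -/
def partialSubalgebra (n k : ℕ) : Subalgebra ℚ (MvPolynomial (Fin n) ℚ) :=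
  Algebra.adjoin ℚ (Set.range (fun j : Fin n => esymm (Fin n) ℚ ((j : ℕ) + 1)) ∪
    X '' {j : Fin n | k ≤ j})

theorem X_mem_partialSubalgebra {k : ℕ} (j : Fin n) (hj : k ≤ j) :
    (X j : MvPolynomial (Fin n) ℚ) ∈ partialSubalgebra n k :=
  Algebra.subset_adjoin (Or.inr ⟨j, hj, rfl⟩)

theorem esymm_mem_partialSubalgebra (k m : ℕ) (hm : m ≤ n) :
    esymm (Fin n) ℚ m ∈ partialSubalgebra n k := by
  rcases m with _ | m
  · rw [esymm_zero]; exact one_mem _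
  · exact Algebra.subset_adjoin (Or.inl ⟨⟨m, hm⟩, rfl⟩)

theorem partialSubalgebra_succ_le (k : ℕ) : partialSubalgebra n (k + 1) ≤ partialSubalgebra n k :=
  Algebra.adjoin_mono (Set.union_subset_union_right _ (Set.image_mono fun j (hj : k + 1 ≤ j) =>
    show k ≤ j by omega))

/-- The polynomial with the first `k` variables as its roots. -/
def rootProduct (n k : ℕ) : Polynomial (MvPolynomial (Fin n) ℚ) :=
  ∏ j ∈ Finset.univ.filter (fun j : Fin n => (j : ℕ) < k), (Polynomial.X - Polynomial.C (X j))

theorem monic_rootProduct (k : ℕ) : (rootProduct n k).Monic :=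
  Polynomial.monic_prod_of_monic _ _ fun _ _ => Polynomial.monic_X_sub_C _

theorem natDegree_rootProduct {k : ℕ} (hk : k ≤ n) : (rootProduct n k).natDegree = k := by
  rw [rootProduct, Polynomial.natDegree_prod_of_monic _ _ fun _ _ => Polynomial.monic_X_sub_C _]
  simp only [Polynomial.natDegree_X_sub_C, Finset.sum_const, smul_eq_mul, mul_one]
  have : (Finset.univ.filter (fun j : Fin n => (j : ℕ) < k)) =
      Finset.univ.map (Fin.castLEEmb hk) := by
    ext j
    simp only [Finset.mem_filter, Finset.mem_univ, true_and, Finset.mem_map, Fin.castLEEmb_apply]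
    exact ⟨fun h => ⟨⟨j, h⟩, rfl⟩, by rintro ⟨i, rfl⟩; exact i.2⟩
  rw [this, Finset.card_map, Finset.card_fin]

theorem rootProduct_succ {k : ℕ} (hk : k < n) :
    rootProduct n (k + 1) = (Polynomial.X - Polynomial.C (X ⟨k, hk⟩)) * rootProduct n k := by
  rw [rootProduct, rootProduct, ← Finset.prod_insert
    (f := fun j : Fin n => Polynomial.X - Polynomial.C (X j : MvPolynomial (Fin n) ℚ)) (by simp)]
  refine Finset.prod_congr (Finset.ext fun j => ?_) fun _ _ => rfl
  simp only [Finset.mem_filter, Finset.mem_univ, true_and, Finset.mem_insert, Fin.ext_iff]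
  omega

/-- Descending induction: for k = n the coefficients are signed elementary symmetric polynomials.
Dividing the product for k + 1 by X - x_k keeps the coefficients in the algebra, since x_k lies in
it. -/
theorem rootProduct_lifts (k : ℕ) (hk : k ≤ n) :
    ∃ g : Polynomial (partialSubalgebra n k),
      g.map (algebraMap (partialSubalgebra n k) (MvPolynomial (Fin n) ℚ)) = rootProduct n k := by
  induction hk using Nat.decreasingInduction with
  | self =>
    rw [← Polynomial.mem_lifts, Polynomial.lifts_iff_coeff_lifts]
    intro m
    rcases le_or_gt m n with hm | hm
    · have h1 : rootProduct n n = ((Finset.univ.val.map fun i : Fin n =>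
          (X i : MvPolynomial (Fin n) ℚ)).map fun t => Polynomial.X - Polynomial.C t).prod := by
        rw [rootProduct, Finset.filter_true_of_mem fun j _ => j.2, Multiset.map_map]
        rfl
      have h2 : Multiset.card (Finset.univ.val.map fun i : Fin n =>
          (X i : MvPolynomial (Fin n) ℚ)) = n := by simp
      rw [h1, Multiset.prod_X_sub_C_coeff _ (by rw [h2]; exact hm), h2,
        ← esymm_eq_multiset_esymm]
      exact ⟨⟨_, mul_mem (pow_mem (neg_mem (one_mem _)) _)
        (esymm_mem_partialSubalgebra n (n - m) (Nat.sub_le _ _))⟩, rfl⟩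
    · rw [Polynomial.coeff_eq_zero_of_natDegree_lt (by rwa [natDegree_rootProduct le_rfl])]
      exact ⟨0, map_zero _⟩
  | @of_succ k hk ih =>
    obtain ⟨g, hg⟩ := ih
    let x : partialSubalgebra n k := ⟨X ⟨k, hk⟩, X_mem_partialSubalgebra _ le_rfl⟩
    let g' := g.map (Subalgebra.inclusion (partialSubalgebra_succ_le (n := n) k)).toRingHom
    have hg' : g'.map (algebraMap (partialSubalgebra n k) (MvPolynomial (Fin n) ℚ)) =
        rootProduct n (k + 1) := by
      rw [← hg, Polynomial.map_map]; rfl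
    have hroot : g'.IsRoot x := by
      have h1 : Polynomial.eval (algebraMap (partialSubalgebra n k) (MvPolynomial (Fin n) ℚ) x)
          (g'.map (algebraMap _ _)) = 0 := by
        rw [hg', rootProduct_succ hk, Polynomial.eval_mul]
        simp [x]
      rw [Polynomial.eval_map_algebraMap, Polynomial.aeval_algebraMap_apply] at h1
      simpa [Polynomial.IsRoot] using h1
    obtain ⟨r, hr⟩ := Polynomial.dvd_iff_isRoot.2 hroot
    refine ⟨r, ?_⟩
    rw [hr, Polynomial.map_mul, rootProduct_succ hk] at hg'
    refine mul_left_cancel₀ (Polynomial.X_sub_C_ne_zero (X ⟨k, hk⟩)) ?_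
    rw [← hg']
    simp [x]

/-- The span of the Artin monomials involving only the variables from the `k`-th onwards. -/
def partialSpan (n k : ℕ) : Submodule ℚ (MvPolynomial (Fin n) ℚ) :=
  Submodule.span ℚ (artinMonomial '' {x | ∀ j : Fin n, (j : ℕ) < k → (x.1 j : ℕ) = 0})

/-- Descending induction along the tower of partial algebras A_k: the polynomial `rootProduct n (k +
1)` is a monic equation of degree k + 1 for x_k over A_{k+1}, so the powers of x_k up to the k-th
span A_k over A_{k+1}. -/
theorem partialSubalgebra_le_partialSpan (k : ℕ) (hk : k ≤ n) :
    ∀ y ∈ partialSubalgebra n k, y ∈ partialSpan n k := by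
  induction hk using Nat.decreasingInduction with
  | self =>
    intro y hy
    have : {j : Fin n | n ≤ j} = ∅ := Set.eq_empty_of_forall_notMem fun j hj =>
      absurd j.2 (not_lt.2 hj)
    rw [partialSubalgebra, this, Set.image_empty, Set.union_empty,
      Algebra.adjoin_range_eq_range_aeval] at hy
    obtain ⟨p, rfl⟩ := hy
    rw [p.as_sum, map_sum]
    refine Submodule.sum_mem _ fun m _ => ?_
    change aeval _ (monomial m _) ∈ _
    rw [aeval_monomial, ← Algebra.smul_def]
    refine Submodule.smul_mem _ _ (Submodule.subset_span ⟨(0, m), fun _ _ => rfl, ?_⟩)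
    rw [artinMonomial, esymmMonomial, Finsupp.prod_fintype _ _ fun _ => pow_zero _]
    simp
  | @of_succ k hk ih =>
    intro y hy
    obtain ⟨g, hg⟩ := rootProduct_lifts (n := n) (k + 1) hk
    have hinj : Function.Injective
        (algebraMap (partialSubalgebra n (k + 1)) (MvPolynomial (Fin n) ℚ)) :=
      Subtype.val_injective
    have hmonic : g.Monic := hinj.monic_map_iff.2 (by rw [hg]; exact monic_rootProduct _)
    have hdeg : g.natDegree = k + 1 := by
      rw [← Polynomial.natDegree_map_eq_of_injective hinj, hg, natDegree_rootProduct hk]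
    have hroot : Polynomial.aeval (X ⟨k, hk⟩ : MvPolynomial (Fin n) ℚ) g = 0 := by
      rw [← Polynomial.eval_map_algebraMap, hg, rootProduct_succ hk]
      simp
    have hset : partialSubalgebra n k = (Algebra.adjoin (partialSubalgebra n (k + 1))
        {(X ⟨k, hk⟩ : MvPolynomial (Fin n) ℚ)}).restrictScalars ℚ := by
      rw [partialSubalgebra, partialSubalgebra, ← Algebra.adjoin_union_eq_adjoin_adjoin,
        Set.union_assoc, ← Set.image_singleton, ← Set.image_union]
      congr 3
      ext j
      simp only [Set.mem_ofPred_eq, Set.mem_union, Set.mem_singleton_iff, Fin.ext_iff]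
      omega
    rw [hset] at hy
    replace hy : y ∈ Subalgebra.toSubmodule (Algebra.adjoin (partialSubalgebra n (k + 1))
        {(X ⟨k, hk⟩ : MvPolynomial (Fin n) ℚ)}) := hy
    rw [← Submodule.span_range_natDegree_eq_adjoin hmonic hroot, hdeg] at hy
    -- The Artin monomials for k + 1 have exponent 0 at x_k, so multiplying by x_k^c only sets that
    -- exponent to c; c < k + 1 is exactly the staircase bound.
    have key : ∀ c < k + 1, ∀ z ∈ partialSpan n (k + 1),
        z * X ⟨k, hk⟩ ^ c ∈ partialSpan n k := by
      intro c hc z hz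
      induction hz using Submodule.span_induction with
      | zero => rw [zero_mul]; exact zero_mem _
      | add u v _ _ hu hv => rw [add_mul]; exact add_mem hu hv
      | smul r u _ hu => rw [smul_mul_assoc]; exact Submodule.smul_mem _ _ hu
      | mem z hz =>
        obtain ⟨⟨a, b⟩, ha, rfl⟩ := hz
        refine Submodule.subset_span ⟨(Function.update a ⟨k, hk⟩ ⟨c, hc⟩, b), ?_, ?_⟩
        · intro j hj
          have hne : j ≠ ⟨k, hk⟩ := by rintro rfl; exact lt_irrefl _ hj
          change ((Function.update a ⟨k, hk⟩ ⟨c, hc⟩ j : Fin _) : ℕ) = 0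
          rw [Function.update_of_ne hne]
          exact ha j (Nat.lt_succ_of_lt hj)
        · have h0 : ((a ⟨k, hk⟩ : ℕ)) = 0 := ha ⟨k, hk⟩ (Nat.lt_succ_self k)
          simp only [artinMonomial]
          rw [mul_right_comm]
          congr 1
          rw [← Finset.mul_prod_erase _ _ (Finset.mem_univ (⟨k, hk⟩ : Fin n)),
            ← Finset.mul_prod_erase _ (fun j => X j ^ (a j : ℕ))
              (Finset.mem_univ (⟨k, hk⟩ : Fin n)), Function.update_self, h0, pow_zero, one_mul,
              mul_comm]
          congr 1
          refine Finset.prod_congr rfl fun j hj => ?_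
          rw [Function.update_of_ne (Finset.ne_of_mem_erase hj)]
    obtain ⟨r, -, rfl⟩ := Submodule.mem_span_finset.1 hy
    refine Submodule.sum_mem _ fun z hz => ?_
    obtain ⟨c, hc, rfl⟩ := (@Finset.mem_image _ _ (_) _ _ _).1 hz
    exact key c (Finset.mem_range.1 hc) _ (ih _ (r _).2)

theorem span_artinMonomial : Submodule.span ℚ (Set.range (artinMonomial (n := n))) = ⊤ := by
  refine eq_top_iff.2 fun y _ => ?_
  have hy : y ∈ partialSubalgebra n 0 := by
    have : (⊤ : Subalgebra ℚ (MvPolynomial (Fin n) ℚ)) ≤ partialSubalgebra n 0 := by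
      rw [← adjoin_range_X]
      exact Algebra.adjoin_le (by rintro _ ⟨j, rfl⟩; exact X_mem_partialSubalgebra j (Nat.zero_le _))
    exact this trivial
  exact Submodule.span_mono (Set.image_subset_range _ _)
    (partialSubalgebra_le_partialSpan 0 (Nat.zero_le n) y hy)

end Artin

/-! ### Independence of the Artin monomials and the coinvariant algebra -/

section ArtinBasis

variable {n : ℕ}

/-- The total degree of an Artin monomial. -/
def artinDegree (x : Staircase n × (Fin n → ℕ)) : ℕ := stairDegree x.1 + esymmDegree x.2

/-- Division with remainder of the `j`-th exponent by `j + 1`. -/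
def artinEquiv (n : ℕ) : Staircase n × (Fin n → ℕ) ≃ (Fin n →₀ ℕ) :=
  ((Equiv.arrowProdEquivProdArrow (Fin n) (fun j => Fin ((j : ℕ) + 1)) fun _ => ℕ).symm.trans
    (Equiv.piCongrRight fun j : Fin n => (Equiv.prodComm _ _).trans
      (Nat.divModEquiv ((j : ℕ) + 1)).symm)).trans Finsupp.equivFunOnFinite.symm

/-- Writing an exponent as a_j + (j + 1) b_j preserves the total degree. Hence there are as many
Artin monomials as ordinary monomials in each degree. -/
theorem degree_artinEquiv (x : Staircase n × (Fin n → ℕ)) :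
    (artinEquiv n x).degree = artinDegree x := by
  rw [Finsupp.degree_eq_sum, artinDegree, stairDegree, esymmDegree, ← Finset.sum_add_distrib]
  refine Finset.sum_congr rfl fun j _ => ?_
  simp [artinEquiv, Nat.divModEquiv]
  ring

instance finite_degree (i : ℕ) : Finite {m : Fin n →₀ ℕ // m.degree = i} := by
  have hw := finite_weighted (ι := Fin n) (d := fun _ => 1) (fun _ => Nat.one_pos) i
  refine Finite.of_injective (β := Weighted (fun _ : Fin n => 1) i)
    (fun m => ⟨m.1, by simpa [Finsupp.degree_eq_sum] using m.2⟩) fun a b h => ?_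
  exact Subtype.ext (DFunLike.coe_injective (Subtype.ext_iff.1 h))

/-- The correspondence of Artin monomials with monomials in each degree. -/
def artinDegreeEquiv (n i : ℕ) :
    {x : Staircase n × (Fin n → ℕ) // artinDegree x = i} ≃ {m : Fin n →₀ ℕ // m.degree = i} :=
  (artinEquiv n).subtypeEquiv fun x => by rw [degree_artinEquiv]

instance (i : ℕ) : Finite {x : Staircase n × (Fin n → ℕ) // artinDegree x = i} :=
  Finite.of_equiv _ (artinDegreeEquiv n i).symm

theorem homogeneousSubmodule_eq_span_monomials (i : ℕ) : homogeneousSubmodule (Fin n) ℚ i =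
    Submodule.span ℚ (basisMonomials (Fin n) ℚ '' {m | m.degree = i}) := by
  rw [homogeneousSubmodule_eq_finsupp_supported, AddMonoidAlgebra.supported_eq_span_single,
    coe_basisMonomials]
  rfl

theorem finrank_homogeneousSubmodule (i : ℕ) : Module.finrank ℚ (homogeneousSubmodule (Fin n) ℚ i) =
    Nat.card {m : Fin n →₀ ℕ // m.degree = i} := by
  have : Fintype ({m | m.degree = i} : Set (Fin n →₀ ℕ)) := @Fintype.ofFinite _ (finite_degree i)
  rw [homogeneousSubmodule_eq_span_monomials, Set.image_eq_range]
  exact (finrank_span_eq_card ((basisMonomials (Fin n) ℚ).linearIndependent.comp _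
    Subtype.val_injective)).trans Fintype.card_eq_nat_card

theorem homogeneousSubmodule_eq_span_artin (i : ℕ) : homogeneousSubmodule (Fin n) ℚ i =
    Submodule.span ℚ (artinMonomial '' {x | artinDegree x = i}) := by
  refine le_antisymm (fun p hp => ?_) (Submodule.span_le.2 ?_)
  · have h1 : homogeneousComponent i p = p := homogeneousComponent_eq_self hp
    rw [← h1]
    have h2 : homogeneousComponent i p ∈ (⊤ : Submodule ℚ (MvPolynomial (Fin n) ℚ)).map
        (homogeneousComponent i) := ⟨p, trivial, rfl⟩
    rw [← span_artinMonomial, Submodule.map_span] at h2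
    refine Submodule.span_le.2 ?_ h2
    rintro _ ⟨_, ⟨x, rfl⟩, rfl⟩
    have hx := isHomogeneous_artinMonomial x
    rw [SetLike.mem_coe, homogeneousComponent_of_mem hx]
    split_ifs with h
    · exact Submodule.subset_span ⟨x, h.symm, rfl⟩
    · exact zero_mem _
  · rintro _ ⟨x, rfl, rfl⟩
    exact isHomogeneous_artinMonomial x

/-- The Artin monomials of degree `i` as a basis of the homogeneous polynomials of degree `i`. -/
def artinBasisDegree (n i : ℕ) :
    Module.Basis {x : Staircase n × (Fin n → ℕ) // artinDegree x = i} ℚ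
      (homogeneousSubmodule (Fin n) ℚ i) :=
  letI := Fintype.ofFinite {x : Staircase n × (Fin n → ℕ) // artinDegree x = i}
  -- Spanning is known, so equality with the dimension replaces a proof of linear independence.
  have hcard : Fintype.card {x : Staircase n × (Fin n → ℕ) // artinDegree x = i} =
      Module.finrank ℚ (homogeneousSubmodule (Fin n) ℚ i) := by
    rw [finrank_homogeneousSubmodule, ← Nat.card_eq_fintype_card,
      Nat.card_congr (artinDegreeEquiv n i)]
  basisOfTopLeSpanOfCardEqFinrank
    (fun x => ⟨artinMonomial x.1, by
      rw [homogeneousSubmodule_eq_span_artin]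
      exact Submodule.subset_span ⟨x.1, x.2, rfl⟩⟩)
    (by
      refine le_of_eq (Submodule.map_injective_of_injective (Submodule.injective_subtype _) ?_)
      rw [Submodule.map_subtype_top, Submodule.map_span, ← Set.range_comp]
      exact (homogeneousSubmodule_eq_span_artin i).trans (congrArg _ (Set.image_eq_range _ _))) hcard

theorem coe_artinBasisDegree (i : ℕ)
    (x : {x : Staircase n × (Fin n → ℕ) // artinDegree x = i}) :
    (artinBasisDegree n i x : MvPolynomial (Fin n) ℚ) = artinMonomial x.1 := by
  simp [artinBasisDegree]

attribute [local instance] MvPolynomial.gradedAlgebra in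
/-- The basis of Artin monomials. -/
def artinBasis (n : ℕ) :
    Module.Basis (Staircase n × (Fin n → ℕ)) ℚ (MvPolynomial (Fin n) ℚ) :=
  ((DirectSum.Decomposition.isInternal (homogeneousSubmodule (Fin n) ℚ)).collectedBasis
    (artinBasisDegree n)).reindex (Equiv.sigmaFiberEquiv artinDegree)

theorem artinBasis_apply (x : Staircase n × (Fin n → ℕ)) : artinBasis n x = artinMonomial x := by
  simp [artinBasis, coe_artinBasisDegree, Equiv.sigmaFiberEquiv]

/-- Multiplication by a symmetric monomial only shifts the second index of the basis. This is the
form in which freeness over the symmetric polynomials enters the trace computation. -/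
theorem artinBasis_repr_mul (p : MvPolynomial (Fin n) ℚ) (a : Staircase n) (b c : Fin n → ℕ) :
    (artinBasis n).repr (p * esymmMonomial c) (a, b + c) = (artinBasis n).repr p (a, b) := by
  have h : (Finsupp.lapply (a, b + c)).comp ((artinBasis n).repr.toLinearMap.comp
      (LinearMap.mulRight ℚ (esymmMonomial c))) =
      (Finsupp.lapply (a, b)).comp (artinBasis n).repr.toLinearMap := by
    classical
    refine (artinBasis n).ext fun x => ?_
    simp only [LinearMap.comp_apply, LinearMap.mulRight_apply, LinearEquiv.coe_coe,
      Finsupp.lapply_apply]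
    rw [artinBasis_apply, artinMonomial_mul, ← artinBasis_apply, ← artinBasis_apply,
      Module.Basis.repr_self, Module.Basis.repr_self, Finsupp.single_apply, Finsupp.single_apply]
    simp [Prod.ext_iff]
  exact LinearMap.congr_fun h p

/-! ### The coinvariant algebra -/

/-- The coordinates of a polynomial with respect to the Artin monomials without elementary
symmetric factors. -/
def stairCoords (n : ℕ) : MvPolynomial (Fin n) ℚ →ₗ[ℚ] (Staircase n →₀ ℚ) :=
  (Finsupp.lcomapDomain (fun a : Staircase n => (a, (0 : Fin n → ℕ)))
    fun _ _ h => (Prod.ext_iff.1 h).1).comp (artinBasis n).repr.toLinearMap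

theorem stairCoords_apply (p : MvPolynomial (Fin n) ℚ) (a : Staircase n) :
    stairCoords n p a = (artinBasis n).repr p (a, 0) := by
  simp [stairCoords, Finsupp.lcomapDomain]

theorem stairCoords_artinMonomial_zero (a : Staircase n) :
    stairCoords n (artinMonomial (a, 0)) = Finsupp.single a 1 := by
  classical
  ext a'
  rw [stairCoords_apply, ← artinBasis_apply, Module.Basis.repr_self, Finsupp.single_apply,
    Finsupp.single_apply]
  simp [Prod.ext_iff]

theorem stairCoords_artinMonomial_ne {a : Staircase n} {b : Fin n → ℕ} (hb : b ≠ 0) :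
    stairCoords n (artinMonomial (a, b)) = 0 := by
  classical
  ext a'
  rw [stairCoords_apply, ← artinBasis_apply, Module.Basis.repr_self, Finsupp.single_apply,
    if_neg (fun h => hb (Prod.ext_iff.1 h).2), Finsupp.zero_apply]

theorem stairCoords_surjective : Function.Surjective (stairCoords n) := by
  rw [← LinearMap.range_eq_top, eq_top_iff, ← (Finsupp.basisSingleOne (R := ℚ)
    (ι := Staircase n)).span_eq, Submodule.span_le]
  rintro _ ⟨a, rfl⟩
  exact ⟨artinMonomial (a, 0), by rw [stairCoords_artinMonomial_zero]; simp⟩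

/-- By the fundamental theorem on symmetric polynomials p is a polynomial in the elementary ones;
only the exponent 0 contributes to the constant term. -/
theorem symmetric_mem_span {p : MvPolynomial (Fin n) ℚ} (hp : p.IsSymmetric)
    (h0 : constantCoeff p = 0) : p ∈ Submodule.span ℚ (esymmMonomial '' {b | b ≠ 0}) := by
  obtain ⟨P, hP⟩ := esymmAlgHom_surjective ℚ (σ := Fin n) (n := n) (by simp)
    (⟨p, hp⟩ : symmetricSubalgebra (Fin n) ℚ)
  have hP' : p = ∑ m ∈ P.support, coeff m P • esymmMonomial m := by
    have h1 : p = aeval (fun i : Fin n => esymm (Fin n) ℚ ((i : ℕ) + 1)) P := by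
      rw [← esymmAlgHom_apply, hP]
    rw [h1, aeval_def, eval₂_eq']
    exact Finset.sum_congr rfl fun m _ => by rw [← Algebra.smul_def, esymmMonomial]
  have hc : coeff 0 P = 0 := by
    rw [hP', map_sum] at h0
    by_contra hne
    rw [Finset.sum_eq_single 0] at h0
    · rw [Finsupp.coe_zero, esymmMonomial_zero, ← C_mul', mul_one, constantCoeff_C] at h0
      exact hne h0
    · intro m _ hm
      rw [← C_mul', map_mul, constantCoeff_esymmMonomial (fun h => hm (DFunLike.coe_injective h)),
        mul_zero]
    · intro h
      rw [notMem_support_iff.1 h, zero_smul, map_zero]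
  rw [hP']
  refine Submodule.sum_mem _ fun m hm => Submodule.smul_mem _ _ (Submodule.subset_span ⟨m, ?_, rfl⟩)
  intro h
  have : m = 0 := DFunLike.coe_injective h
  rw [this, mem_support_iff] at hm
  exact hm hc

theorem stairCoords_mul_symmetric {p : MvPolynomial (Fin n) ℚ} (hp : p.IsSymmetric)
    (h0 : constantCoeff p = 0) (s : MvPolynomial (Fin n) ℚ) : stairCoords n (s * p) = 0 := by
  have hs : s ∈ Submodule.span ℚ (Set.range (artinMonomial (n := n))) := by
    rw [span_artinMonomial]; trivial
  have hp' := symmetric_mem_span hp h0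
  induction hs using Submodule.span_induction with
  | zero => rw [zero_mul, map_zero]
  | add u v _ _ hu hv => rw [add_mul, map_add, hu, hv, add_zero]
  | smul r u _ hu => rw [smul_mul_assoc, map_smul, hu, smul_zero]
  | mem z hz =>
    obtain ⟨⟨a, b⟩, rfl⟩ := hz
    clear hp h0
    induction hp' using Submodule.span_induction with
    | zero => rw [mul_zero, map_zero]
    | add u v _ _ hu hv => rw [mul_add, map_add, hu, hv, add_zero]
    | smul r u _ hu => rw [mul_smul_comm, map_smul, hu, smul_zero]
    | mem z hz =>
      obtain ⟨c, hc, rfl⟩ := hz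
      rw [artinMonomial_mul]
      refine stairCoords_artinMonomial_ne fun h => hc (funext fun j => ?_)
      have := congrFun h j
      simp only [Pi.add_apply, Pi.zero_apply] at this ⊢
      omega

/-- Both sides are the span of the Artin monomials with a nontrivial symmetric factor. -/
theorem ker_stairCoords :
    LinearMap.ker (stairCoords n) = (coinvariantIdeal n).restrictScalars ℚ := by
  refine le_antisymm (fun p hp => ?_) fun p hp => ?_
  · rw [LinearMap.mem_ker] at hp
    rw [Submodule.restrictScalars_mem, ← (artinBasis n).linearCombination_repr p,
      Finsupp.linearCombination_apply]
    refine Submodule.sum_mem _ fun x _ => ?_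
    obtain ⟨a, b⟩ := x
    by_cases hb : b = 0
    · subst hb
      have := DFunLike.congr_fun hp a
      rw [stairCoords_apply, Finsupp.zero_apply] at this
      simp only [this, zero_smul]
      exact zero_mem _
    · simp only
      rw [artinBasis_apply, ← C_mul']
      exact Ideal.mul_mem_left _ _ (Ideal.mul_mem_left _ _ (Ideal.subset_span
        ⟨isSymmetric_esymmMonomial b, constantCoeff_esymmMonomial hb⟩))
  · rw [LinearMap.mem_ker]
    suffices h : ∀ s, stairCoords n (s * p) = 0 by simpa using h 1
    rw [Submodule.restrictScalars_mem, coinvariantIdeal, Ideal.span] at hp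
    induction hp using Submodule.span_induction with
    | zero => intro s; rw [mul_zero, map_zero]
    | add u v _ _ hu hv => intro s; rw [mul_add, map_add, hu, hv, add_zero]
    | smul r u _ hu => intro s; rw [smul_eq_mul, ← mul_assoc, hu]
    | mem z hz => exact stairCoords_mul_symmetric hz.1 hz.2

/-- The basis of the coinvariant algebra given by the monomials under the staircase. -/
def coinvariantBasis (n : ℕ) : Module.Basis (Staircase n) ℚ (CoinvariantAlgebra n) :=
  Module.Basis.ofRepr ((Submodule.Quotient.restrictScalarsEquiv ℚ (coinvariantIdeal n)).symm.trans
    ((Submodule.quotEquivOfEq _ _ ker_stairCoords.symm).trans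
      ((stairCoords n).quotKerEquivOfSurjective stairCoords_surjective)))

theorem coinvariantBasis_repr (p : MvPolynomial (Fin n) ℚ) (a : Staircase n) :
    (coinvariantBasis n).repr (Ideal.Quotient.mk (coinvariantIdeal n) p) a =
      (artinBasis n).repr p (a, 0) := by
  rw [← stairCoords_apply]
  rfl

theorem coinvariantBasis_apply (a : Staircase n) :
    coinvariantBasis n a = Ideal.Quotient.mk (coinvariantIdeal n) (artinMonomial (a, 0)) := by
  refine (coinvariantBasis n).repr.injective (Finsupp.ext fun a' => ?_)
  rw [coinvariantBasis_repr, Module.Basis.repr_self, ← stairCoords_apply,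
    stairCoords_artinMonomial_zero]

theorem coinvariantPart_eq_span (i : ℕ) : coinvariantPart n i =
    Submodule.span ℚ (coinvariantBasis n '' {a | stairDegree a = i}) := by
  rw [coinvariantPart, homogeneousSubmodule_eq_span_artin, Submodule.map_span]
  refine le_antisymm (Submodule.span_le.2 ?_) (Submodule.span_mono ?_)
  · rintro _ ⟨_, ⟨⟨a, b⟩, hx, rfl⟩, rfl⟩
    by_cases hb : b = 0
    · subst hb
      exact Submodule.subset_span ⟨a, by simpa [artinDegree, esymmDegree] using hx,
        coinvariantBasis_apply a⟩
    · have : (Ideal.Quotient.mkₐ ℚ (coinvariantIdeal n)).toLinearMap (artinMonomial (a, b)) = 0 :=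
        Ideal.Quotient.eq_zero_iff_mem.2 (Ideal.mul_mem_left _ _ (Ideal.subset_span
          ⟨isSymmetric_esymmMonomial b, constantCoeff_esymmMonomial hb⟩))
      rw [SetLike.mem_coe, this]
      exact zero_mem _
  · rintro _ ⟨a, ha, rfl⟩
    refine ⟨artinMonomial (a, 0), ⟨(a, 0), ?_, rfl⟩, (coinvariantBasis_apply a).symm⟩
    have : stairDegree a = i := ha
    simp [artinDegree, esymmDegree, this]

theorem coinvariantPart_eq_bot {i : ℕ} (h : ∀ a : Staircase n, stairDegree a ≠ i) :
    coinvariantPart n i = ⊥ := by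
  rw [coinvariantPart_eq_span, Submodule.span_eq_bot]
  rintro _ ⟨a, ha, -⟩
  exact absurd ha (h a)

theorem finite_coinvariantPart_ne_bot : {i : ℕ | coinvariantPart n i ≠ ⊥}.Finite := by
  refine (Set.finite_range (stairDegree (n := n))).subset fun i hi => ?_
  by_contra h
  exact hi (coinvariantPart_eq_bot fun a ha => h ⟨a, ha⟩)

end ArtinBasis

/-! ### The graded character, from traces on polynomials in two bases -/

section Molien

variable {n : ℕ} (w : Equiv.Perm (Fin n))

/-- The diagonal entry at `a` of the action of `w` on the coinvariant algebra. -/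
def diagCoeff (a : Staircase n) : ℚ :=
  (artinBasis n).repr (rename w (artinMonomial (a, 0))) (a, 0)

theorem character_coinvariantPartRep (i : ℕ) : (coinvariantPartRep n i).character w =
    ∑ a : Staircase n with stairDegree a = i, diagCoeff w a := by
  have h := trace_restrict_span (coinvariantBasis n) {a | stairDegree a = i}
    (coinvariantPart_eq_span i) (coinvariantRep n w) (coinvariantPart_le_comap n i w)
  rw [Finset.sum_subtype (p := fun a => a ∈ {a : Staircase n | stairDegree a = i}) _ (by simp)]
  refine Eq.trans ?_ (h.trans (Finset.sum_congr rfl fun a _ => ?_))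
  · rfl
  · rw [coinvariantBasis_apply]
    exact coinvariantBasis_repr _ _

/-- Renaming variables is linear over the symmetric polynomials, so the diagonal entry at (a, b)
equals the one at (a, 0). Summing over b counts weighted exponents of the degree left over by a. -/
theorem trace_rename_eq_diagCoeff (i : ℕ)
    (hf : ∀ p ∈ homogeneousSubmodule (Fin n) ℚ i,
      (rename (R := ℚ) w).toLinearMap p ∈ homogeneousSubmodule (Fin n) ℚ i) :
    LinearMap.trace ℚ _ ((rename (R := ℚ) w).toLinearMap.restrict hf) =
      PowerSeries.coeff i ((PowerSeries.mk fun m =>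
        (Nat.card (Weighted (fun j : Fin n => (j : ℕ) + 1) m) : ℚ)) *
        ∑ a : Staircase n, PowerSeries.C (diagCoeff w a) * PowerSeries.X ^ stairDegree a) := by
  have hfin : ∀ a : Staircase n, Finite {b : Fin n → ℕ // artinDegree (a, b) = i} := fun a =>
    Finite.of_injective
      (β := {x : Staircase n × (Fin n → ℕ) // artinDegree x = i})
      (fun b => ⟨(a, b.1), b.2⟩) fun b c h => Subtype.ext (Prod.ext_iff.1 (Subtype.ext_iff.1 h)).2
  have := fun a : Staircase n => Fintype.ofFinite {b : Fin n → ℕ // artinDegree (a, b) = i}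
  have : Fintype ({x | artinDegree x = i} : Set (Staircase n × (Fin n → ℕ))) :=
    @Fintype.ofFinite _ (inferInstanceAs (Finite {x // artinDegree x = i}))
  rw [trace_restrict_span (artinBasis n) {x | artinDegree x = i} (by
    rw [homogeneousSubmodule_eq_span_artin]; congr 2; exact (funext artinBasis_apply).symm)]
  have h1 : ∀ x : ({x | artinDegree x = i} : Set (Staircase n × (Fin n → ℕ))),
      (artinBasis n).repr ((rename (R := ℚ) w).toLinearMap (artinBasis n x)) x =
        diagCoeff w x.1.1 := by
    rintro ⟨⟨a, b⟩, -⟩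
    have h2 := artinBasis_repr_mul (rename w (artinMonomial (a, 0))) a 0 b
    rw [zero_add] at h2
    rw [diagCoeff, ← h2, artinBasis_apply]
    have h3 : artinMonomial (a, b) = artinMonomial (a, 0) * esymmMonomial b := by
      rw [artinMonomial_mul, zero_add]
    rw [h3, AlgHom.toLinearMap_apply, map_mul, isSymmetric_esymmMonomial b w]
  rw [Finset.sum_congr rfl fun x _ => h1 x]
  let e : ({x | artinDegree x = i} : Set (Staircase n × (Fin n → ℕ))) ≃
      Σ a : Staircase n, {b : Fin n → ℕ // artinDegree (a, b) = i} :=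
    { toFun := fun x => ⟨x.1.1, x.1.2, x.2⟩
      invFun := fun y => ⟨(y.1, y.2.1), y.2.2⟩
      left_inv := fun _ => rfl
      right_inv := fun _ => rfl }
  rw [(Fintype.sum_equiv e _ (fun y => diagCoeff w y.1) (fun _ => rfl) :
    ∑ x : ({x | artinDegree x = i} : Set (Staircase n × (Fin n → ℕ))), diagCoeff w x.1.1 = _),
    Fintype.sum_sigma, Finset.mul_sum, map_sum]
  refine Finset.sum_congr rfl fun a _ => ?_
  dsimp only
  rw [mul_left_comm, PowerSeries.coeff_C_mul, PowerSeries.coeff_mul_X_pow', Finset.sum_const,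
    nsmul_eq_mul, mul_comm]
  congr 1
  rw [Finset.card_univ, Fintype.card_eq_nat_card]
  split_ifs with h
  · rw [PowerSeries.coeff_mk]
    congr 1
    refine Nat.card_congr (Equiv.subtypeEquivRight fun b => ?_)
    simp only [artinDegree, esymmDegree]
    omega
  · have : IsEmpty {b : Fin n → ℕ // artinDegree (a, b) = i} :=
      ⟨fun b => h (by have := b.2; simp only [artinDegree] at this; omega)⟩
    simp

/-- Exponents of a given degree fixed by `w` correspond to weighted exponents on the orbits. -/
def fixedExponentEquiv (i : ℕ) : Weighted (fun c : Orbits w => orbitLength c) i ≃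
    {m : {m : Fin n →₀ ℕ // m.degree = i} // ∀ j, m.1 (w j) = m.1 j} where
  toFun b := ⟨⟨Finsupp.equivFunOnFinite.symm fun j => b.1 (Quotient.mk _ j), by
    rw [Finsupp.degree_eq_sum]
    exact (sum_orbits w b.1).trans b.2⟩, fun j => by simp [mk_apply]⟩
  invFun m := ⟨fun c => m.1.1 c.out, by
    have h : ∀ j, m.1.1 (Quotient.mk (Equiv.Perm.SameCycle.setoid w) j).out = m.1.1 j := by
      intro j
      obtain ⟨k, hk⟩ := exists_iterate_out w j
      conv_rhs => rw [← hk]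
      clear hk
      induction k with
      | zero => rfl
      | succ k ih => rw [Function.iterate_succ_apply', m.2, ih]
    have h1 := sum_orbits w fun c => m.1.1 c.out
    simp only [smul_eq_mul, h] at h1
    rw [← h1, ← Finsupp.degree_eq_sum, m.1.2]⟩
  left_inv b := Subtype.ext (funext fun c => by simp)
  right_inv m := by
    refine Subtype.ext (Subtype.ext (Finsupp.ext fun j => ?_))
    obtain ⟨k, hk⟩ := exists_iterate_out w j
    simp only [Finsupp.equivFunOnFinite_symm_apply_apply]
    conv_rhs => rw [← hk]
    clear hk
    induction k with
    | zero => rfl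
    | succ k ih => rw [Function.iterate_succ_apply', m.2, ih]

/-- In the monomial basis w acts as a permutation, so the trace counts fixed monomials, those whose
exponents are constant on the orbits of w. -/
theorem trace_rename_eq_card (i : ℕ)
    (hf : ∀ p ∈ homogeneousSubmodule (Fin n) ℚ i,
      (rename (R := ℚ) w).toLinearMap p ∈ homogeneousSubmodule (Fin n) ℚ i) :
    LinearMap.trace ℚ _ ((rename (R := ℚ) w).toLinearMap.restrict hf) =
      Nat.card (Weighted (fun c : Orbits w => orbitLength c) i) := by
  classical
  have : Fintype ({m | m.degree = i} : Set (Fin n →₀ ℕ)) := @Fintype.ofFinite _ (finite_degree i)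
  rw [trace_restrict_span (basisMonomials (Fin n) ℚ) {m | m.degree = i}
    (homogeneousSubmodule_eq_span_monomials i)]
  have h1 : ∀ m : Fin n →₀ ℕ, (basisMonomials (Fin n) ℚ).repr
      ((rename (R := ℚ) w).toLinearMap (basisMonomials (Fin n) ℚ m)) m =
      if ∀ j, m (w j) = m j then 1 else 0 := by
    intro m
    have h2 : (rename (R := ℚ) w).toLinearMap (basisMonomials (Fin n) ℚ m) =
        basisMonomials (Fin n) ℚ (m.mapDomain w) := by
      simp [rename_monomial]
    rw [h2, Module.Basis.repr_self, Finsupp.single_apply]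
    congr 1
    refine propext ⟨fun h j => ?_, fun h => Finsupp.ext fun j => ?_⟩
    · conv_lhs => rw [← h]
      exact Finsupp.mapDomain_apply w.injective _ _
    · obtain ⟨j, rfl⟩ := w.surjective j
      rw [Finsupp.mapDomain_apply w.injective, h]
  rw [Finset.sum_congr rfl fun m _ => h1 m.1, Finset.sum_boole, ← Fintype.card_subtype,
    Fintype.card_eq_nat_card]
  exact congrArg _ (Nat.card_congr (fixedExponentEquiv w i)).symm

/-- The graded character of the coinvariant algebra. -/
theorem graded_character_mul : (∑ a : Staircase n,
    Polynomial.C (diagCoeff w a) * Polynomial.X ^ stairDegree a) *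
      ∏ c : Orbits w, (1 - Polynomial.X ^ orbitLength c) =
    ∏ j : Fin n, (1 - Polynomial.X ^ ((j : ℕ) + 1) : Polynomial ℚ) := by
  have h1 := weighted_series (d := fun c : Orbits w => orbitLength c) orbitLength_pos
  have h2 := weighted_series (d := fun j : Fin n => (j : ℕ) + 1) fun _ => Nat.succ_pos _
  have h3 : (PowerSeries.mk fun m =>
      (Nat.card (Weighted (fun c : Orbits w => orbitLength c) m) : ℚ)) =
      (PowerSeries.mk fun m => (Nat.card (Weighted (fun j : Fin n => (j : ℕ) + 1) m) : ℚ)) *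
        ∑ a : Staircase n, PowerSeries.C (diagCoeff w a) * PowerSeries.X ^ stairDegree a := by
    ext i
    have hf : ∀ p ∈ homogeneousSubmodule (Fin n) ℚ i,
      (rename (R := ℚ) w).toLinearMap p ∈ homogeneousSubmodule (Fin n) ℚ i :=
      fun p hp => IsHomogeneous.rename_isHomogeneous hp
    rw [PowerSeries.coeff_mk, ← trace_rename_eq_card w i hf, trace_rename_eq_diagCoeff w i hf]
  rw [h3] at h1
  apply Polynomial.coe_injective
  have h4 : ∀ {ι : Type} [Fintype ι] (f : ι → Polynomial ℚ),
      ((∏ i, f i : Polynomial ℚ) : PowerSeries ℚ) = ∏ i, (f i : PowerSeries ℚ) := fun f =>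
    map_prod (Polynomial.coeToPowerSeries.ringHom (R := ℚ)) f _
  have h5 : ∀ {ι : Type} [Fintype ι] (f : ι → Polynomial ℚ),
      ((∑ i, f i : Polynomial ℚ) : PowerSeries ℚ) = ∑ i, (f i : PowerSeries ℚ) := fun f =>
    map_sum (Polynomial.coeToPowerSeries.ringHom (R := ℚ)) f _
  simp only [Polynomial.coe_mul, h4, h5, Polynomial.coe_sub, Polynomial.coe_one,
    Polynomial.coe_pow, Polynomial.coe_X, Polynomial.coe_C]
  set A := PowerSeries.mk fun m => (Nat.card (Weighted (fun j : Fin n => (j : ℕ) + 1) m) : ℚ)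
  set P := ∏ j : Fin n, (1 - PowerSeries.X ^ ((j : ℕ) + 1) : PowerSeries ℚ)
  set T := ∑ a : Staircase n, PowerSeries.C (diagCoeff w a) * PowerSeries.X ^ stairDegree a
  set Q := ∏ c : Orbits w, (1 - PowerSeries.X ^ orbitLength c : PowerSeries ℚ)
  -- A is inverse to P, and A * T is the generating series inverse to Q.
  calc T * Q = (A * P) * (T * Q) := by rw [h2, one_mul]
    _ = (A * T * Q) * P := by ring
    _ = P := by rw [h1, one_mul]

end Molien

/-! ### Maximal tori and frames -/

section Frames

variable {n : ℕ} {K : Type*} [Field K]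

/-- The diagonal invertible matrices. -/
def diagGL (n : ℕ) (K : Type*) [Field K] : (Fin n → Kˣ) →* GL (Fin n) K :=
  (Units.map (Matrix.diagonalRingHom (Fin n) K : (Fin n → K) →* Matrix (Fin n) (Fin n) K)).comp
    MulEquiv.piUnits.symm.toMonoidHom

theorem coe_diagGL (d : Fin n → Kˣ) :
    (diagGL n K d : Matrix (Fin n) (Fin n) K) = Matrix.diagonal fun i => (d i : K) := rfl

/-- The torus of matrices that are diagonal in the basis of columns of `g`. -/
def frameTorus (g : GL (Fin n) K) : Subgroup (GL (Fin n) K) :=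
  ((MulAut.conj g).toMonoidHom.comp (diagGL n K)).range

theorem mem_frameTorus {g t : GL (Fin n) K} :
    t ∈ frameTorus g ↔ ∃ d, g * diagGL n K d * g⁻¹ = t := Iff.rfl

theorem exists_diagGL_eq {t : GL (Fin n) K} (ht : (t : Matrix (Fin n) (Fin n) K).IsDiag) :
    ∃ d, diagGL n K d = t := by
  have h0 : ∀ i, (t : Matrix (Fin n) (Fin n) K) i i ≠ 0 := by
    have h1 : (t : Matrix (Fin n) (Fin n) K).det ≠ 0 :=
      ((Matrix.isUnit_iff_isUnit_det _).1 t.isUnit).ne_zero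
    rw [← ht.diagonal_diag, Matrix.det_diagonal, Finset.prod_ne_zero_iff] at h1
    exact fun i => h1 i (Finset.mem_univ i)
  refine ⟨fun i => Units.mk0 _ (h0 i), Units.ext ?_⟩
  rw [coe_diagGL]
  exact ht.diagonal_diag

theorem mem_frameTorus_iff_isDiag {g t : GL (Fin n) K} : t ∈ frameTorus g ↔
    ((g⁻¹ * t * g : GL (Fin n) K) : Matrix (Fin n) (Fin n) K).IsDiag := by
  constructor
  · rintro ⟨d, rfl⟩
    have : g⁻¹ * (g * diagGL n K d * g⁻¹) * g = diagGL n K d := by group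
    change ((g⁻¹ * (g * diagGL n K d * g⁻¹) * g : GL (Fin n) K) :
      Matrix (Fin n) (Fin n) K).IsDiag
    rw [this, coe_diagGL]
    exact Matrix.isDiag_diagonal _
  · intro h
    obtain ⟨d, hd⟩ := exists_diagGL_eq h
    exact ⟨d, by change g * diagGL n K d * g⁻¹ = t; rw [hd]; group⟩

theorem isClosed_zeroLocus (S : Set (MvPolynomial (Fin n × Fin n) K)) :
    @IsClosed _ (zariski n K) {g | ∀ p ∈ S, evalEntries g p = 0} := by
  let _ := zariski n K
  have : {g : GL (Fin n) K | ∀ p ∈ S, evalEntries g p = 0} =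
      ⋂ p ∈ S, {g | evalEntries g p ≠ 0}ᶜ := by
    ext g; simp
  rw [this]
  exact isClosed_biInter fun p _ =>
    (show IsOpen {g : GL (Fin n) K | evalEntries g p ≠ 0} from
      TopologicalSpace.isOpen_generateFrom_of_mem ⟨p, rfl⟩).isClosed_compl

theorem isClosed_frameTorus (g : GL (Fin n) K) :
    @IsClosed _ (zariski n K) (frameTorus g : Set (GL (Fin n) K)) := by
  let P : Fin n → Fin n → MvPolynomial (Fin n × Fin n) K := fun i j =>
    ∑ l, (∑ k, C ((g⁻¹ : GL (Fin n) K) i k) * X (k, l)) * C (g l j)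
  have hP : ∀ (t : GL (Fin n) K) i j, evalEntries t (P i j) =
      ((g⁻¹ * t * g : GL (Fin n) K) : Matrix (Fin n) (Fin n) K) i j := by
    intro t i j
    simp only [evalEntries, P, map_sum, map_mul, aeval_X, aeval_C, Algebra.algebraMap_self,
      RingHom.id_apply, Units.val_mul, Matrix.mul_apply]
  have : (frameTorus g : Set (GL (Fin n) K)) =
      {t | ∀ p ∈ {p | ∃ i j, i ≠ j ∧ p = P i j}, evalEntries t p = 0} := by
    ext t
    rw [SetLike.mem_coe, mem_frameTorus_iff_isDiag]
    constructor
    · rintro h _ ⟨i, j, hij, rfl⟩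
      rw [hP]; exact h hij
    · intro h i j hij
      rw [← hP]; exact h _ ⟨i, j, hij, rfl⟩
  rw [this]
  exact isClosed_zeroLocus _

/-- The nonvanishing locus of p * q is the intersection of those of p and q, so these sets are
already stable under finite intersections. -/
theorem isTopologicalBasis_zariski : @TopologicalSpace.IsTopologicalBasis _ (zariski n K)
    {U | ∃ p : MvPolynomial (Fin n × Fin n) K, U = {g | evalEntries g p ≠ 0}} := by
  let _ := zariski n K
  refine ⟨?_, ?_, rfl⟩
  · rintro _ ⟨p, rfl⟩ _ ⟨q, rfl⟩ x hx
    refine ⟨_, ⟨p * q, rfl⟩, ?_, ?_⟩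
    · simpa [evalEntries] using hx
    · intro y hy
      simpa [evalEntries] using hy
  · refine Set.eq_univ_of_forall fun x => ⟨_, ⟨1, rfl⟩, ?_⟩
    simp [evalEntries]

/-- The torus is parametrised by d ↦ g diag(d) g⁻¹. Polynomials not vanishing identically on it pull
back to nonzero polynomials in d, whose product is nonzero somewhere because K is infinite.
Irreducibility gives the connectedness required of a torus. -/
theorem isPreirreducible_frameTorus [Infinite K] (g : GL (Fin n) K) :
    @IsPreirreducible _ (zariski n K) (frameTorus g : Set (GL (Fin n) K)) := by
  let _ := zariski n K
  let pb : MvPolynomial (Fin n × Fin n) K →ₐ[K] MvPolynomial (Fin n) K :=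
    aeval fun ij => ∑ k, C (g ij.1 k) * X k * C ((g⁻¹ : GL (Fin n) K) k ij.2)
  have hpb : ∀ (p : MvPolynomial (Fin n × Fin n) K) (d : Fin n → Kˣ),
      eval (fun i => (d i : K)) (pb p) = evalEntries (g * diagGL n K d * g⁻¹) p := by
    intro p d
    have : (aeval fun i => (d i : K)).comp pb = aeval fun ij : Fin n × Fin n =>
        ((g * diagGL n K d * g⁻¹ : GL (Fin n) K) : Matrix (Fin n) (Fin n) K) ij.1 ij.2 := by
      refine algHom_ext fun ij => ?_
      simp [pb, coe_diagGL, Matrix.mul_apply, Matrix.diagonal_apply]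
    exact DFunLike.congr_fun this p
  intro u v hu hv
  rintro ⟨_, ⟨d, rfl⟩, hdu⟩ ⟨_, ⟨e, rfl⟩, hev⟩
  obtain ⟨_, ⟨p, rfl⟩, hp, hpu⟩ := isTopologicalBasis_zariski.exists_subset_of_mem_open hdu hu
  obtain ⟨_, ⟨q, rfl⟩, hq, hqv⟩ := isTopologicalBasis_zariski.exists_subset_of_mem_open hev hv
  have hp0 : pb p ≠ 0 := fun h => hp (by have := hpb p d; rw [h, map_zero] at this; exact this.symm)
  have hq0 : pb q ≠ 0 := fun h => hq (by have := hpb q e; rw [h, map_zero] at this; exact this.symm)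
  -- The factor ∏ X_i makes all coordinates of the chosen point invertible.
  have hne : pb p * pb q * ∏ i, X i ≠ 0 := mul_ne_zero (mul_ne_zero hp0 hq0)
    (Finset.prod_ne_zero_iff.2 fun i _ => X_ne_zero i)
  obtain ⟨x, hx⟩ : ∃ x, eval x (pb p * pb q * ∏ i, X i) ≠ 0 := by
    by_contra h
    push Not at h
    exact hne (MvPolynomial.funext fun x => by rw [h, map_zero])
  simp only [map_mul, map_prod, eval_X, mul_ne_zero_iff, Finset.prod_ne_zero_iff] at hx
  have hd := hpb p fun i => Units.mk0 (x i) (hx.2 i (Finset.mem_univ i))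
  have he := hpb q fun i => Units.mk0 (x i) (hx.2 i (Finset.mem_univ i))
  simp only [Units.val_mk0] at hd he
  refine ⟨_, ⟨fun i => Units.mk0 (x i) (hx.2 i (Finset.mem_univ i)), rfl⟩, hpu ?_, hqv ?_⟩
  · exact fun h => hx.1.1 (hd.trans h)
  · exact fun h => hx.1.2 (he.trans h)

theorem isTorus_frameTorus [Infinite K] (g : GL (Fin n) K) : IsTorus (frameTorus g) where
  isClosed := isClosed_frameTorus g
  isConnected := by
    let _ := zariski n K
    exact ⟨⟨1, one_mem _⟩, (isPreirreducible_frameTorus g).isPreconnected⟩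
  diagonalizable := ⟨g, fun _ ht => mem_frameTorus_iff_isDiag.1 ht⟩

theorem exists_injective_units (n : ℕ) (K : Type*) [Field K] [Infinite K] :
    ∃ d : Fin n → Kˣ, Function.Injective d := by
  have : Infinite Kˣ := by
    rw [unitsEquivNeZero.infinite_iff]
    exact (Set.finite_singleton (0 : K)).infinite_compl.to_subtype
  exact ⟨_, ((Fin.valEmbedding).trans (Infinite.natEmbedding Kˣ)).injective⟩

theorem isDiag_of_commute {M : Matrix (Fin n) (Fin n) K} {d : Fin n → K}
    (hd : Function.Injective d) (h : M * Matrix.diagonal d = Matrix.diagonal d * M) :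
    M.IsDiag := by
  intro i j hij
  have := congrFun (congrFun h i) j
  rw [Matrix.mul_diagonal, Matrix.diagonal_mul, mul_comm] at this
  by_contra hne
  exact hij (hd (mul_right_cancel₀ hne this)).symm

theorem mul_comm_of_mem_frameTorus {g s t : GL (Fin n) K} (hs : s ∈ frameTorus g)
    (ht : t ∈ frameTorus g) : s * t = t * s := by
  obtain ⟨d, rfl⟩ := hs
  obtain ⟨e, rfl⟩ := ht
  rw [← map_mul, ← map_mul, mul_comm]

/-- The smaller torus contains an element with distinct eigenvalues. The larger torus is
commutative, so it centralises this element and is diagonal in the frame of g. -/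
theorem frameTorus_eq_of_le [Infinite K] {g h : GL (Fin n) K} (hle : frameTorus g ≤ frameTorus h) :
    frameTorus h ≤ frameTorus g := by
  obtain ⟨d, hd⟩ := exists_injective_units n K
  intro t ht
  have h1 := mul_comm_of_mem_frameTorus ht (hle (mem_frameTorus.2 ⟨d, rfl⟩))
  rw [mem_frameTorus_iff_isDiag]
  refine isDiag_of_commute (d := fun i => (d i : K)) (fun i j hij => hd (Units.ext hij)) ?_
  rw [← coe_diagGL, ← Units.val_mul, ← Units.val_mul]
  congr 1
  calc g⁻¹ * t * g * diagGL n K d = g⁻¹ * (t * (g * diagGL n K d * g⁻¹)) * g := by group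
    _ = g⁻¹ * (g * diagGL n K d * g⁻¹ * t) * g := by rw [h1]
    _ = diagGL n K d * (g⁻¹ * t * g) := by group

theorem IsTorus.exists_le_frameTorus {T : Subgroup (GL (Fin n) K)} (hT : IsTorus T) :
    ∃ g, T ≤ frameTorus g := by
  obtain ⟨g, hg⟩ := hT.diagonalizable
  exact ⟨g, fun t ht => mem_frameTorus_iff_isDiag.2 (hg t ht)⟩

theorem isMaximalTorus_iff [Infinite K] {T : Subgroup (GL (Fin n) K)} :
    IsMaximalTorus T ↔ ∃ g, T = frameTorus g := by
  constructor
  · intro hT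
    obtain ⟨g, hg⟩ := hT.prop.exists_le_frameTorus
    exact ⟨g, le_antisymm hg (hT.2 (isTorus_frameTorus g) hg)⟩
  · rintro ⟨g, rfl⟩
    refine ⟨isTorus_frameTorus g, fun S hS hle => ?_⟩
    obtain ⟨h, hh⟩ := hS.exists_le_frameTorus
    exact hh.trans (frameTorus_eq_of_le (hle.trans hh))

/-- The line spanned by the `i`-th column of `g`. -/
def frameLine (g : GL (Fin n) K) (i : Fin n) : Submodule K (Fin n → K) :=
  Submodule.span K {fun a => g a i}

theorem column_eq_mulVec (g : GL (Fin n) K) (i : Fin n) : (fun a => g a i) =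
    Matrix.mulVec (g : Matrix (Fin n) (Fin n) K) (Pi.single i 1) := by
  rw [Matrix.mulVec_single_one]; rfl

theorem inv_mulVec_column (g : GL (Fin n) K) (i : Fin n) :
    Matrix.mulVec ((g⁻¹ : GL (Fin n) K) : Matrix (Fin n) (Fin n) K) (fun a => g a i) =
      Pi.single i 1 := by
  rw [column_eq_mulVec, Matrix.mulVec_mulVec, ← Units.val_mul, inv_mul_cancel, Units.val_one,
    Matrix.one_mulVec]

theorem column_ne_zero (g : GL (Fin n) K) (i : Fin n) : (fun a => g a i) ≠ 0 := by
  intro h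
  have := inv_mulVec_column g i
  rw [h, Matrix.mulVec_zero] at this
  simpa using congrFun this i

theorem finrank_frameLine (g : GL (Fin n) K) (i : Fin n) : Module.finrank K (frameLine g i) = 1 :=
  finrank_span_singleton (column_ne_zero g i)

theorem frameLine_injective (g : GL (Fin n) K) : Function.Injective (frameLine g) := by
  intro i j hij
  have h1 : (fun a => g a i) ∈ frameLine g j := hij ▸ Submodule.mem_span_singleton_self _
  obtain ⟨c, hc⟩ := Submodule.mem_span_singleton.1 h1
  have h2 := inv_mulVec_column g i
  rw [← hc, Matrix.mulVec_smul, inv_mulVec_column] at h2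
  by_contra hne
  have := congrFun h2 i
  simp [Pi.single_eq_of_ne hne] at this

theorem diag_mulVec_column (g : GL (Fin n) K) (d : Fin n → Kˣ) (i : Fin n) :
    Matrix.mulVec ((g * diagGL n K d * g⁻¹ : GL (Fin n) K) : Matrix (Fin n) (Fin n) K)
      (fun a => g a i) = (d i : K) • fun a => g a i := by
  rw [Units.val_mul, ← Matrix.mulVec_mulVec, inv_mulVec_column, Units.val_mul,
    ← Matrix.mulVec_mulVec, coe_diagGL, Matrix.mulVec_single_one]
  have : (Matrix.diagonal fun i => (d i : K)).col i = (d i : K) • Pi.single i (1 : K) := by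
    ext a
    by_cases h : a = i
    · subst h; simp
    · simp [h]
  rw [this, Matrix.mulVec_smul, ← column_eq_mulVec]

/-- Being the stabiliser of all its lines, the torus is determined by the unordered set of them. -/
theorem mem_frameTorus_iff_lines {g t : GL (Fin n) K} : t ∈ frameTorus g ↔
    ∀ L ∈ Set.range (frameLine g), ∀ v ∈ L,
      Matrix.mulVec (t : Matrix (Fin n) (Fin n) K) v ∈ L := by
  constructor
  · rintro ⟨d, rfl⟩ _ ⟨i, rfl⟩ v hv
    obtain ⟨c, rfl⟩ := Submodule.mem_span_singleton.1 hv
    change Matrix.mulVec ((g * diagGL n K d * g⁻¹ : GL (Fin n) K) : Matrix (Fin n) (Fin n) K) _ ∈ _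
    rw [Matrix.mulVec_smul, diag_mulVec_column]
    exact Submodule.smul_mem _ _ (Submodule.smul_mem _ _ (Submodule.mem_span_singleton_self _))
  · intro h
    rw [mem_frameTorus_iff_isDiag]
    intro i j hij
    obtain ⟨c, hc⟩ := Submodule.mem_span_singleton.1
      (h _ ⟨j, rfl⟩ _ (Submodule.mem_span_singleton_self _))
    have h1 : Matrix.mulVec ((g⁻¹ * t * g : GL (Fin n) K) : Matrix (Fin n) (Fin n) K)
        (Pi.single j 1) = c • Pi.single j 1 := by
      rw [Units.val_mul, ← Matrix.mulVec_mulVec, ← column_eq_mulVec, Units.val_mul,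
        ← Matrix.mulVec_mulVec, ← hc, Matrix.mulVec_smul, inv_mulVec_column]
    rw [Matrix.mulVec_single_one] at h1
    have := congrFun h1 i
    simpa [Pi.single_eq_of_ne hij] using this

/-- An eigenvector of an element with distinct eigenvalues has a single nonzero coordinate in the
frame, so no further line is preserved. -/
theorem eigenlines_frameTorus [Infinite K] (g : GL (Fin n) K) :
    eigenlines (frameTorus g) = Set.range (frameLine g) := by
  ext L
  constructor
  · rintro ⟨hL, hT⟩
    obtain ⟨d, hd⟩ := exists_injective_units n K
    obtain ⟨⟨v, hvL⟩, hv0, hv⟩ := finrank_eq_one_iff'.1 hL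
    have hv0' : v ≠ 0 := fun h => hv0 (Subtype.ext h)
    have hspan : L = Submodule.span K {v} := by
      refine le_antisymm (fun x hx => ?_) (by simpa using hvL)
      obtain ⟨c, hc⟩ := hv ⟨x, hx⟩
      exact Submodule.mem_span_singleton.2 ⟨c, Subtype.ext_iff.1 hc⟩
    have h1 := hT _ (mem_frameTorus.2 ⟨d, rfl⟩) v hvL
    rw [hspan] at h1
    obtain ⟨c, hc⟩ := Submodule.mem_span_singleton.1 h1
    set u := Matrix.mulVec ((g⁻¹ : GL (Fin n) K) : Matrix (Fin n) (Fin n) K) v with hu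
    have hgu : Matrix.mulVec (g : Matrix (Fin n) (Fin n) K) u = v := by
      rw [hu, Matrix.mulVec_mulVec, ← Units.val_mul, mul_inv_cancel, Units.val_one,
        Matrix.one_mulVec]
    have h2 : ∀ j, (d j : K) * u j = c * u j := by
      intro j
      have h3 : Matrix.mulVec (Matrix.diagonal fun i => (d i : K)) u = c • u := by
        rw [hu, ← Matrix.mulVec_smul, hc, ← coe_diagGL, Matrix.mulVec_mulVec,
          Matrix.mulVec_mulVec, ← Units.val_mul, ← Units.val_mul]
        congr 2
        group
      simpa [Matrix.mulVec_diagonal] using congrFun h3 j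
    obtain ⟨i, hi⟩ : ∃ i, u i ≠ 0 := by
      by_contra h
      push Not at h
      exact hv0' (by rw [← hgu, show u = 0 from funext h, Matrix.mulVec_zero])
    have hui : u = u i • Pi.single i 1 := by
      ext j
      by_cases hj : j = i
      · subst hj; simp
      · have : u j = 0 := by
          by_contra hne
          exact hj (hd (Units.ext ((mul_right_cancel₀ hne (h2 j)).trans
            (mul_right_cancel₀ hi (h2 i)).symm)))
        simp [this, Pi.single_eq_of_ne hj]
    refine ⟨i, ?_⟩
    rw [hspan, ← hgu, hui, Matrix.mulVec_smul, ← column_eq_mulVec, frameLine]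
    exact (Submodule.span_singleton_smul_eq (IsUnit.mk0 _ hi) _).symm
  · rintro ⟨i, rfl⟩
    exact ⟨finrank_frameLine g i, fun t ht => mem_frameTorus_iff_lines.1 ht _ ⟨i, rfl⟩⟩

theorem frameTorus_eq_of_range_eq {g h : GL (Fin n) K}
    (hgh : Set.range (frameLine g) = Set.range (frameLine h)) : frameTorus g = frameTorus h := by
  ext t
  rw [mem_frameTorus_iff_lines, mem_frameTorus_iff_lines, hgh]

end Frames

/-! ### The Frobenius map -/

section Frobenius

variable {F : Type*} [Field F] [Fintype F]

variable (F) in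
/-- The Frobenius automorphism of the algebraic closure. -/
def frob : AlgebraicClosure F ≃ₐ[F] AlgebraicClosure F :=
  FiniteField.frobeniusAlgEquivOfAlgebraic F (AlgebraicClosure F)

theorem frob_apply (x : AlgebraicClosure F) : frob F x = x ^ Fintype.card F := rfl

/-- The polynomial X^q - X has at most q roots, and the elements of F already provide q of them. -/
theorem exists_algebraMap_eq {x : AlgebraicClosure F} (hx : frob F x = x) :
    ∃ a : F, algebraMap F (AlgebraicClosure F) a = x := by
  classical
  have h0 : (Polynomial.X ^ Fintype.card F - Polynomial.X :
      Polynomial (AlgebraicClosure F)) ≠ 0 :=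
    FiniteField.X_pow_card_sub_X_ne_zero _ Fintype.one_lt_card
  have hsub : Finset.univ.map ⟨algebraMap F (AlgebraicClosure F), (algebraMap F _).injective⟩ ⊆
      (Polynomial.X ^ Fintype.card F - Polynomial.X :
        Polynomial (AlgebraicClosure F)).roots.toFinset := by
    intro y hy
    obtain ⟨a, -, rfl⟩ := Finset.mem_map.1 hy
    rw [Multiset.mem_toFinset, Polynomial.mem_roots h0]
    simp [Polynomial.IsRoot, ← map_pow, FiniteField.pow_card]
  have heq := Finset.eq_of_subset_of_card_le hsub (by
    refine (Multiset.toFinset_card_le _).trans ((Polynomial.card_roots' _).trans ?_)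
    rw [FiniteField.X_pow_card_sub_X_natDegree_eq _ Fintype.one_lt_card, Finset.card_map,
      Finset.card_univ])
  have hx' : x ∈ (Polynomial.X ^ Fintype.card F - Polynomial.X :
      Polynomial (AlgebraicClosure F)).roots.toFinset := by
    rw [Multiset.mem_toFinset, Polynomial.mem_roots h0]
    simpa [Polynomial.IsRoot, sub_eq_zero, frob_apply] using hx
  rw [← heq] at hx'
  obtain ⟨a, -, ha⟩ := Finset.mem_map.1 hx'
  exact ⟨a, ha⟩

theorem one_lt_card_pow {l : ℕ} (hl : 0 < l) : 1 < Fintype.card F ^ l :=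
  Nat.one_lt_pow hl.ne' Fintype.one_lt_card

variable (F) in
-- In F the number q^l - 1 equals -1, so it is prime to the characteristic and the closure has all
-- q^l - 1 roots of unity of that order.
theorem neZero_card_pow_sub_one {l : ℕ} (hl : 0 < l) :
    NeZero ((Fintype.card F ^ l - 1 : ℕ) : F) := by
  refine ⟨?_⟩
  rw [Nat.cast_sub (one_lt_card_pow hl).le, Nat.cast_pow, FiniteField.cast_card_eq_zero,
    zero_pow hl.ne', Nat.cast_one, zero_sub]
  exact neg_ne_zero.2 one_ne_zero

theorem iterate_pow_apply {M : Type*} [Monoid M] (m k : ℕ) (x : M) :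
    (fun y : M => y ^ m)^[k] x = x ^ m ^ k := by
  rw [pow_iterate]

theorem card_fixed_units {l : ℕ} (hl : 0 < l) :
    Nat.card {x : (AlgebraicClosure F)ˣ // (fun y => y ^ Fintype.card F)^[l] x = x} =
      Fintype.card F ^ l - 1 := by
  have := neZero_card_pow_sub_one F hl
  have : NeZero (Fintype.card F ^ l - 1) := .of_neZero_natCast F
  rw [← HasEnoughRootsOfUnity.natCard_rootsOfUnity (AlgebraicClosure F) (Fintype.card F ^ l - 1)]
  refine Nat.card_congr (Equiv.subtypeEquivRight fun x => ?_)
  rw [iterate_pow_apply, mem_rootsOfUnity]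
  conv_lhs => rw [← Nat.sub_add_cancel (one_lt_card_pow (F := F) hl).le, pow_succ]
  exact mul_eq_right

/-! ### Families and bases permuted by Frobenius -/

section Families

variable {n : ℕ} (w : Equiv.Perm (Fin n))

theorem card_equivariant_units :
    Nat.card {d : Fin n → (AlgebraicClosure F)ˣ // ∀ i, d (w i) = d i ^ Fintype.card F} =
      ∏ c : Orbits w, (Fintype.card F ^ orbitLength c - 1) := by
  rw [← Finset.prod_congr rfl fun c _ => card_fixed_units (F := F) (orbitLength_pos c),
    ← Nat.card_pi]
  refine Nat.card_congr ((equivariantEquiv w fun _ (y : (AlgebraicClosure F)ˣ) =>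
    y ^ Fintype.card F).trans (Equiv.piCongrRight fun c => Equiv.subtypeEquivRight fun x => ?_))
  rw [orbitMap_const]

theorem apply_iterate_of_equivariant {r : Fin n → AlgebraicClosure F}
    (hr : ∀ i, r (w i) = r i ^ Fintype.card F) (k : ℕ) (i : Fin n) :
    r (w^[k] i) = r i ^ Fintype.card F ^ k := by
  induction k with
  | zero => simp
  | succ k ih => rw [Function.iterate_succ_apply', hr, ih, ← pow_mul, pow_succ]

/-- Families compatible with Frobenius separate the indices. -/
theorem exists_equivariant_separating {i j : Fin n} (hij : i ≠ j) :
    ∃ r : Fin n → AlgebraicClosure F, (∀ i, r (w i) = r i ^ Fintype.card F) ∧ r i ≠ r j := by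
  classical
  set c : Orbits w := Quotient.mk _ i with hc
  have := neZero_card_pow_sub_one F (orbitLength_pos c)
  have hN : Fintype.card F ^ orbitLength c - 1 ≠ 0 :=
    (Nat.sub_pos_of_lt (one_lt_card_pow (orbitLength_pos c))).ne'
  obtain ⟨ζ, hζ⟩ := HasEnoughRootsOfUnity.exists_primitiveRoot (AlgebraicClosure F)
    (Fintype.card F ^ orbitLength c - 1)
  have hζ0 : ζ ≠ 0 := hζ.ne_zero hN
  -- The family vanishes off the orbit of i and runs through the Frobenius conjugates of ζ on it;
  -- ζ^(q^l) = ζ, with l the orbit length, makes this consistent.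
  obtain ⟨r, hr, hr'⟩ := exists_equivariant (w := w)
    (f := fun _ (y : AlgebraicClosure F) => y ^ Fintype.card F)
    (fun c' => if c' = c then ζ else 0) (by
      intro c'
      rw [orbitMap_const, iterate_pow_apply]
      split_ifs with h
      · subst h
        conv_lhs => rw [← Nat.sub_add_cancel (one_lt_card_pow (F := F) (orbitLength_pos c)).le,
          pow_succ, hζ.pow_eq_one, one_mul]
      · rw [zero_pow (pow_ne_zero _ Fintype.card_ne_zero)])
  refine ⟨r, hr, ?_⟩
  obtain ⟨a, ha⟩ := (orbitEquiv w c).surjective ⟨i, hc.symm⟩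
  have ha' : w^[a] c.out = i := Subtype.ext_iff.1 ha
  have hri : r i = ζ ^ Fintype.card F ^ (a : ℕ) := by
    rw [← ha', apply_iterate_of_equivariant w hr, hr', if_pos rfl]
  by_cases hj : (Quotient.mk _ j : Orbits w) = c
  · obtain ⟨b, hb⟩ := (orbitEquiv w c).surjective ⟨j, hj⟩
    have hb' : w^[b] c.out = j := Subtype.ext_iff.1 hb
    have hrj : r j = ζ ^ Fintype.card F ^ (b : ℕ) := by
      rw [← hb', apply_iterate_of_equivariant w hr, hr', if_pos rfl]
    rw [hri, hrj]
    intro h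
    have hab : (a : ℕ) ≠ b := fun h => hij (by rw [← ha', ← hb', h])
    -- Distinct exponents below the order of ζ give distinct powers. Two different indices force
    -- orbit length at least 2, which excludes the failing case q = 2, l = 1.
    have hlt : ∀ m < orbitLength c, Fintype.card F ^ m < Fintype.card F ^ orbitLength c - 1 := by
      intro m hm
      have hl : 2 ≤ orbitLength c := by have := a.2; have := b.2; omega
      have hq : 2 ≤ Fintype.card F := Fintype.one_lt_card
      obtain ⟨l, hl'⟩ : ∃ l, orbitLength c = l + 1 := ⟨orbitLength c - 1, by omega⟩
      have h1 : Fintype.card F ^ m ≤ Fintype.card F ^ l :=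
        Nat.pow_le_pow_right (by omega) (by omega)
      have h2 : 1 < Fintype.card F ^ l := one_lt_card_pow (by omega)
      have h3 : Fintype.card F ^ l * 2 ≤ Fintype.card F ^ orbitLength c := by
        rw [hl', pow_succ]; exact Nat.mul_le_mul_left _ hq
      omega
    exact hab (Nat.pow_right_injective Fintype.one_lt_card
      (hζ.pow_inj (hlt _ a.2) (hlt _ b.2) h))
  · have hrj : r j = 0 := by
      obtain ⟨k, hk⟩ := exists_iterate_out w j
      rw [← hk, apply_iterate_of_equivariant w hr, hr', if_neg hj,
        zero_pow (pow_ne_zero _ Fintype.card_ne_zero)]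
    rw [hri, hrj]
    exact pow_ne_zero _ hζ0

/-- Vectors compatible with Frobenius and a permutation of the coordinates span. -/
theorem span_equivariant : Submodule.span (AlgebraicClosure F)
    {r : Fin n → AlgebraicClosure F | ∀ i, r (w i) = r i ^ Fintype.card F} = ⊤ := by
  -- The compatible vectors are closed under coordinatewise multiplication, so the coordinates are
  -- characters of a monoid. They are distinct by separation, hence independent by Dedekind, and no
  -- nonzero linear form kills all compatible vectors.
  let G : Submonoid (Fin n → AlgebraicClosure F) :=
    { carrier := {r | ∀ i, r (w i) = r i ^ Fintype.card F}
      one_mem' := fun i => by simp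
      mul_mem' := fun {r s} hr hs i => by
        rw [Pi.mul_apply, Pi.mul_apply, hr, hs, mul_pow] }
  let coord : Fin n → (G →* AlgebraicClosure F) := fun i =>
    (Pi.evalMonoidHom _ i).comp G.subtype
  have hcoord : Function.Injective coord := by
    intro i j hij
    by_contra hne
    obtain ⟨r, hr, hrij⟩ := exists_equivariant_separating (F := F) w hne
    exact hrij (DFunLike.congr_fun hij (⟨r, hr⟩ : G))
  have hli := (linearIndependent_monoidHom G (AlgebraicClosure F)).comp coord hcoord
  by_contra hne
  obtain ⟨f, hf, hle⟩ := Submodule.exists_le_ker_of_lt_top _ (lt_top_iff_ne_top.2 hne)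
  have hzero := Fintype.linearIndependent_iff.1 hli (fun i => f (Pi.single i 1)) (by
    ext r
    have h1 : f r.1 = 0 := hle (Submodule.subset_span r.2)
    rw [LinearMap.pi_apply_eq_sum_univ f] at h1
    simp only [Finset.sum_apply, Pi.smul_apply, Function.comp_apply, Pi.zero_apply]
    rw [← h1]
    refine Finset.sum_congr rfl fun i _ => ?_
    rw [smul_eq_mul, smul_eq_mul, mul_comm]
    congr 2
    ext j
    simp [Pi.single_apply, eq_comm])
  refine hf (LinearMap.pi_ext' fun i => LinearMap.ext_ring ?_)
  simpa using hzero i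

/-- The bases whose members are permuted by Frobenius according to `w`. -/
def FrobBases (F : Type*) [Field F] [Fintype F] (w : Equiv.Perm (Fin n)) : Type _ :=
  {g : GL (Fin n) (AlgebraicClosure F) // ∀ a i, frob F (g a i) = g a (w i)}

/-- Independent compatible vectors, n in number, are taken as the rows of g; compatibility of the
rows is the Frobenius condition on the columns. This plays the role of Lang's theorem for GL_n. -/
instance nonempty_frobBases : Nonempty (FrobBases F w) := by
  obtain ⟨f, hf, -, hli⟩ := Submodule.exists_fun_fin_finrank_span_eq (AlgebraicClosure F)
    {r : Fin n → AlgebraicClosure F | ∀ i, r (w i) = r i ^ Fintype.card F}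
  have hn : n = Module.finrank (AlgebraicClosure F) (Submodule.span (AlgebraicClosure F)
      {r : Fin n → AlgebraicClosure F | ∀ i, r (w i) = r i ^ Fintype.card F}) := by
    rw [span_equivariant, finrank_top, Module.finrank_fin_fun]
  have hunit : IsUnit (Matrix.of fun a i => f (Fin.cast hn a) i) := by
    rw [← Matrix.linearIndependent_rows_iff_isUnit]
    exact hli.comp _ (Fin.cast_injective hn)
  exact ⟨⟨hunit.unit, fun a i => (hf (Fin.cast hn a) i).symm⟩⟩

/-- For two such bases g and g₀ the permutation of columns cancels in g g₀⁻¹, which is therefore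
fixed by Frobenius and has entries in F. So GL_n(F) acts simply transitively from the left. -/
theorem card_frobBases : Nat.card (FrobBases F w) = Nat.card (GL (Fin n) F) := by
  obtain ⟨g₀⟩ := nonempty_frobBases (F := F) w
  let ψ := Matrix.GeneralLinearGroup.map (n := Fin n) (algebraMap F (AlgebraicClosure F))
  let φ := Matrix.GeneralLinearGroup.map (n := Fin n) (RingHomClass.toRingHom (frob F))
  have hψ : Function.Injective ψ := by
    intro a b hab
    refine Units.ext (Matrix.ext fun i j => (algebraMap F (AlgebraicClosure F)).injective ?_)
    exact congrArg (fun g : GL (Fin n) (AlgebraicClosure F) =>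
      (g : Matrix (Fin n) (Fin n) (AlgebraicClosure F)) i j) hab
  have hφψ : ∀ h, φ (ψ h) = ψ h := fun h => Units.ext (Matrix.ext fun i j =>
    (frob F).commutes (h i j))
  have hφ : ∀ g : GL (Fin n) (AlgebraicClosure F), (∀ a i, frob F (g a i) = g a (w i)) ↔
      ((φ g : GL (Fin n) (AlgebraicClosure F)) : Matrix (Fin n) (Fin n) (AlgebraicClosure F)) =
        (g : Matrix (Fin n) (Fin n) (AlgebraicClosure F)).submatrix id w :=
    fun g => ⟨fun h => Matrix.ext h, fun h a i => congrFun (congrFun h a) i⟩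
  have hmem : ∀ h, ∀ a i, frob F ((ψ h * g₀.1 : GL (Fin n) (AlgebraicClosure F)) a i) =
      (ψ h * g₀.1 : GL (Fin n) (AlgebraicClosure F)) a (w i) := by
    intro h
    rw [hφ, map_mul, hφψ, Units.val_mul, Units.val_mul, (hφ g₀.1).1 g₀.2,
      Matrix.submatrix_mul _ _ id id w Function.bijective_id, Matrix.submatrix_id_id]
  refine (Nat.card_congr (Equiv.ofBijective (fun h => (⟨ψ h * g₀.1, hmem h⟩ : FrobBases F w))
    ⟨?_, ?_⟩)).symm
  · intro a b hab
    exact hψ (mul_right_cancel (Subtype.ext_iff.1 hab))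
  · rintro ⟨g, hg⟩
    have hfix : φ (g * g₀.1⁻¹) = g * g₀.1⁻¹ := by
      rw [map_mul, map_inv, mul_inv_eq_iff_eq_mul]
      refine Units.ext ?_
      rw [Units.val_mul, (hφ g).1 hg, (hφ g₀.1).1 g₀.2]
      have : (g : Matrix (Fin n) (Fin n) (AlgebraicClosure F)) =
          ((g * g₀.1⁻¹ : GL (Fin n) (AlgebraicClosure F)) : Matrix (Fin n) (Fin n) (AlgebraicClosure F)) * (g₀.1 : Matrix (Fin n) (Fin n) (AlgebraicClosure F)) := by
        rw [← Units.val_mul, inv_mul_cancel_right]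
      conv_lhs => rw [this]
      rw [Matrix.submatrix_mul _ _ id id w Function.bijective_id, Matrix.submatrix_id_id]
    have hex : ∀ i j, ∃ a : F, algebraMap F (AlgebraicClosure F) a =
        (g * g₀.1⁻¹ : GL (Fin n) (AlgebraicClosure F)) i j := fun i j =>
      exists_algebraMap_eq (congrArg
        (fun g : GL (Fin n) (AlgebraicClosure F) =>
          (g : Matrix (Fin n) (Fin n) (AlgebraicClosure F)) i j) hfix)
    choose M hM using hex
    have hMmap : (algebraMap F (AlgebraicClosure F)).mapMatrix (Matrix.of M) =
        ((g * g₀.1⁻¹ : GL (Fin n) (AlgebraicClosure F)) : Matrix (Fin n) (Fin n) (AlgebraicClosure F)) := Matrix.ext hM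
    have hunit : IsUnit (Matrix.of M) := by
      rw [Matrix.isUnit_iff_isUnit_det, isUnit_iff_ne_zero]
      intro h0
      have h1 : ((g * g₀.1⁻¹ : GL (Fin n) (AlgebraicClosure F)) : Matrix (Fin n) (Fin n) (AlgebraicClosure F)).det ≠ 0 :=
        ((Matrix.isUnit_iff_isUnit_det _).1 (Units.isUnit _)).ne_zero
      rw [← hMmap, ← RingHom.map_det, h0, map_zero] at h1
      exact h1 rfl
    refine ⟨hunit.unit, Subtype.ext ?_⟩
    have : ψ hunit.unit = g * g₀.1⁻¹ := Units.ext hMmap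
    change ψ hunit.unit * g₀.1 = g
    rw [this, inv_mul_cancel_right]

instance finite_frobBases : Finite (FrobBases F w) := by
  refine Nat.finite_of_card_ne_zero ?_
  rw [card_frobBases]
  exact Nat.card_pos.ne'

end Families

end Frobenius

/-! ### Rationality of tori, and the count of permuted frames -/

section Rational

variable {F : Type*} [Field F] {n : ℕ}

/-- Families of lines spanned by the members of a basis. -/
def IsFrame (L : Fin n → Submodule (AlgebraicClosure F) (Fin n → AlgebraicClosure F)) : Prop :=
  ∃ g : GL (Fin n) (AlgebraicClosure F), frameLine g = L

theorem IsFrame.of_range_subset {g : GL (Fin n) (AlgebraicClosure F)}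
    {L : Fin n → Submodule (AlgebraicClosure F) (Fin n → AlgebraicClosure F)}
    (hL : Function.Injective L) (hr : Set.range L ⊆ Set.range (frameLine g)) : IsFrame L := by
  have h : ∀ i, ∃ j, frameLine g j = L i := fun i => hr ⟨i, rfl⟩
  choose π hπ using h
  have hinj : Function.Injective π := fun i j hij => hL (by rw [← hπ, ← hπ, hij])
  let e : Equiv.Perm (Fin n) := Equiv.ofBijective π (Finite.injective_iff_bijective.1 hinj)
  have hunit : IsUnit ((g : Matrix (Fin n) (Fin n) (AlgebraicClosure F)).submatrix
      (Equiv.refl _) e) := (Matrix.isUnit_submatrix_equiv _ _).2 g.isUnit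
  exact ⟨hunit.unit, funext fun i => hπ i⟩

theorem maxTori_ext {T T' : MaxTori n F} (h : eigenlines T.1 = eigenlines T'.1) : T = T' := by
  obtain ⟨T, hT, hF⟩ := T
  obtain ⟨T', hT', hF'⟩ := T'
  obtain ⟨g, rfl⟩ := isMaximalTorus_iff.1 hT
  obtain ⟨g', rfl⟩ := isMaximalTorus_iff.1 hT'
  rw [eigenlines_frameTorus, eigenlines_frameTorus] at h
  exact Subtype.ext (frameTorus_eq_of_range_eq h)

theorem isFrame_of_eigenlines {T : MaxTori n F}
    {L : Fin n → Submodule (AlgebraicClosure F) (Fin n → AlgebraicClosure F)}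
    (hL : Function.Injective L) (hr : Set.range L = eigenlines T.1) : IsFrame L := by
  obtain ⟨T, hT, hF⟩ := T
  obtain ⟨g, rfl⟩ := isMaximalTorus_iff.1 hT
  exact IsFrame.of_range_subset hL (hr.trans (eigenlines_frameTorus g)).subset

variable [Fintype F]

variable (F n) in
/-- The Frobenius endomorphism of the general linear group. -/
def frobGL : GL (Fin n) (AlgebraicClosure F) →* GL (Fin n) (AlgebraicClosure F) :=
  Matrix.GeneralLinearGroup.map (RingHomClass.toRingHom (frob F))

theorem frobGL_apply (g : GL (Fin n) (AlgebraicClosure F)) (i j : Fin n) :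
    frobGL F n g i j = frob F (g i j) := rfl

theorem evalEntries_frobGL (g : GL (Fin n) (AlgebraicClosure F))
    (p : MvPolynomial (Fin n × Fin n) F) :
    evalEntries (frobGL F n g) p = frob F (evalEntries g p) := by
  have h : aeval (fun ij : Fin n × Fin n => frobGL F n g ij.1 ij.2) =
      (frob F : AlgebraicClosure F →ₐ[F] AlgebraicClosure F).comp
        (aeval fun ij : Fin n × Fin n => g ij.1 ij.2) :=
    algHom_ext fun ij => by simp [frobGL_apply]
  exact DFunLike.congr_fun h p

theorem frobGL_mem_iff {T : Subgroup (GL (Fin n) (AlgebraicClosure F))} (hT : IsDefinedOver F T)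
    (g : GL (Fin n) (AlgebraicClosure F)) : frobGL F n g ∈ T ↔ g ∈ T := by
  obtain ⟨S, hS⟩ := hT
  rw [hS, hS]
  refine forall₂_congr fun p _ => ?_
  rw [evalEntries_frobGL, map_eq_zero_iff _ (frob F).injective]

/-- Equations over F make the torus Frobenius-stable. Every diagonal matrix is the Frobenius image
of a diagonal matrix, which gives one inclusion; inclusions between frame tori are equalities. -/
theorem frameTorus_frobGL {g : GL (Fin n) (AlgebraicClosure F)}
    (hT : IsDefinedOver F (frameTorus g)) : frameTorus (frobGL F n g) = frameTorus g := by
  have hle : frameTorus (frobGL F n g) ≤ frameTorus g := by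
    rintro _ ⟨d, rfl⟩
    let e : Fin n → (AlgebraicClosure F)ˣ := fun i =>
      Units.map ((frob F).symm : AlgebraicClosure F →* AlgebraicClosure F) (d i)
    have h : frobGL F n (diagGL n _ e) = diagGL n _ d := by
      refine Units.ext (Matrix.ext fun i j => ?_)
      rw [frobGL_apply, coe_diagGL, coe_diagGL, Matrix.diagonal_apply, Matrix.diagonal_apply]
      split_ifs
      · exact (frob F).apply_symm_apply _
      · exact map_zero _
    change frobGL F n g * diagGL n _ d * (frobGL F n g)⁻¹ ∈ _
    rw [← h, ← map_inv, ← map_mul, ← map_mul, frobGL_mem_iff hT]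
    exact mem_frameTorus.2 ⟨e, rfl⟩
  exact le_antisymm hle (frameTorus_eq_of_le hle)

theorem frobeniusImage_frameLine (g : GL (Fin n) (AlgebraicClosure F)) (i : Fin n) :
    frobeniusImage (Fintype.card F) (frameLine g i) = frameLine (frobGL F n g) i := by
  refine le_antisymm (Submodule.span_le.2 ?_) (Submodule.span_le.2 ?_)
  · rintro _ ⟨v, hv, rfl⟩
    obtain ⟨c, rfl⟩ := Submodule.mem_span_singleton.1 hv
    refine Submodule.mem_span_singleton.2 ⟨frob F c, funext fun a => ?_⟩
    simp [frobGL_apply, frob_apply, mul_pow]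
  · rintro _ rfl
    exact Submodule.subset_span ⟨_, Submodule.mem_span_singleton_self _, rfl⟩

/-- Frobenius carries the lines of g to those of `frobGL F n g`, which belong to the same torus and
so are the same lines in another order. -/
theorem exists_isFrobeniusPermutation {T : Subgroup (GL (Fin n) (AlgebraicClosure F))}
    (hT : IsMaximalTorus T) (hF : IsDefinedOver F T) :
    ∃ σ, IsFrobeniusPermutation (Fintype.card F) T σ := by
  obtain ⟨g, rfl⟩ := isMaximalTorus_iff.1 hT
  have h : ∀ i, ∃ j, frameLine g j = frameLine (frobGL F n g) i := fun i => by
    have h1 : frameLine (frobGL F n g) i ∈ eigenlines (frameTorus (frobGL F n g)) := by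
      rw [eigenlines_frameTorus]; exact ⟨i, rfl⟩
    rwa [frameTorus_frobGL hF, eigenlines_frameTorus] at h1
  choose σ hσ using h
  have hinj : Function.Injective σ := fun i j hij =>
    frameLine_injective (frobGL F n g) (by rw [← hσ, ← hσ, hij])
  refine ⟨Equiv.ofBijective σ (Finite.injective_iff_bijective.1 hinj), frameLine g,
    frameLine_injective g, (eigenlines_frameTorus g).symm, fun i => ?_⟩
  rw [frobeniusImage_frameLine, ← hσ]
  rfl

/-- The torus of a basis permuted by Frobenius is defined over the base field. -/
theorem isDefinedOver_frameTorus {w : Equiv.Perm (Fin n)} (g : FrobBases F w) :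
    IsDefinedOver F (frameTorus g.1) := by
  -- For r compatible with w, the matrix with eigenvalue r_i on the i-th column of g is
  -- Frobenius-invariant, hence has entries in F. The torus is the centraliser of all these
  -- matrices, and commuting with them is expressed by equations over F.
  let N : (Fin n → AlgebraicClosure F) → Matrix (Fin n) (Fin n) (AlgebraicClosure F) := fun r =>
    (g.1 : Matrix (Fin n) (Fin n) (AlgebraicClosure F)) * Matrix.diagonal r *
      ((g.1⁻¹ : GL (Fin n) (AlgebraicClosure F)) : Matrix (Fin n) (Fin n) (AlgebraicClosure F))
  have hinv : ((g.1⁻¹ : GL (Fin n) (AlgebraicClosure F)) :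
      Matrix (Fin n) (Fin n) (AlgebraicClosure F)) *
      (g.1 : Matrix (Fin n) (Fin n) (AlgebraicClosure F)) = 1 := Units.inv_mul _
  have hinv' : (g.1 : Matrix (Fin n) (Fin n) (AlgebraicClosure F)) *
      ((g.1⁻¹ : GL (Fin n) (AlgebraicClosure F)) :
        Matrix (Fin n) (Fin n) (AlgebraicClosure F)) = 1 := Units.mul_inv _
  have hNg : ∀ r, N r * (g.1 : Matrix (Fin n) (Fin n) (AlgebraicClosure F)) =
      (g.1 : Matrix (Fin n) (Fin n) (AlgebraicClosure F)) * Matrix.diagonal r := fun r => by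
    simp only [N]
    rw [Matrix.mul_assoc, hinv, Matrix.mul_one]
  have hN : ∀ r : Fin n → AlgebraicClosure F, (∀ i, r (w i) = r i ^ Fintype.card F) →
      ∀ i j, ∃ a : F, algebraMap F (AlgebraicClosure F) a = N r i j := by
    intro r hr i j
    refine exists_algebraMap_eq ?_
    have h1 : (N r).map (frob F) * (g.1 : Matrix (Fin n) (Fin n) (AlgebraicClosure F)) =
        (g.1 : Matrix (Fin n) (Fin n) (AlgebraicClosure F)) * Matrix.diagonal r := by
      ext a b
      obtain ⟨b, rfl⟩ := w.surjective b
      have h2 := congrArg (frob F) (congrFun (congrFun (hNg r) a) b)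
      rw [Matrix.mul_diagonal, Matrix.mul_apply, map_sum, map_mul, g.2, frob_apply (r b),
        ← hr] at h2
      rw [Matrix.mul_diagonal, Matrix.mul_apply, ← h2]
      exact Finset.sum_congr rfl fun c _ => by rw [map_mul, g.2, Matrix.map_apply]
    have h3 : (N r).map (frob F) = N r := by
      rw [← Matrix.mul_one ((N r).map (frob F)), ← hinv', ← Matrix.mul_assoc, h1]
    exact congrFun (congrFun h3 i) j
  let P : Matrix (Fin n) (Fin n) F → Fin n → Fin n → MvPolynomial (Fin n × Fin n) F :=
    fun M i j => ∑ k, X (i, k) * C (M k j) - ∑ k, C (M i k) * X (k, j)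
  have hP : ∀ (t : GL (Fin n) (AlgebraicClosure F)) M i j, evalEntries t (P M i j) =
      ((t : Matrix (Fin n) (Fin n) (AlgebraicClosure F)) * M.map (algebraMap F (AlgebraicClosure F))) i j -
        (M.map (algebraMap F (AlgebraicClosure F)) * (t : Matrix (Fin n) (Fin n) (AlgebraicClosure F))) i j := by
    intro t M i j
    simp [evalEntries, P, Matrix.mul_apply]
  refine ⟨{p | ∃ (r : Fin n → AlgebraicClosure F) (M : Matrix (Fin n) (Fin n) F) (i j : Fin n),
    (∀ i, r (w i) = r i ^ Fintype.card F) ∧ M.map (algebraMap F (AlgebraicClosure F)) = N r ∧ p = P M i j},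
    fun t => ⟨?_, fun h => ?_⟩⟩
  · rintro ⟨d, rfl⟩ _ ⟨r, M, i, j, -, hM, rfl⟩
    rw [hP, hM, sub_eq_zero]
    refine congrFun (congrFun ?_ i) j
    change (g.1 : Matrix (Fin n) (Fin n) (AlgebraicClosure F)) * Matrix.diagonal _ *
      ((g.1⁻¹ : GL (Fin n) (AlgebraicClosure F)) : Matrix (Fin n) (Fin n) (AlgebraicClosure F)) *
      N r = N r * (N _)
    have h4 : ∀ r s, N r * N s = N (r * s) := by
      intro r s
      change N r * (_ * _ * _) = _
      rw [← Matrix.mul_assoc, ← Matrix.mul_assoc, hNg, Matrix.mul_assoc _ (Matrix.diagonal r),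
        Matrix.diagonal_mul_diagonal]
      rfl
    change N _ * N r = N r * N _
    rw [h4, h4, mul_comm]
  · rw [mem_frameTorus_iff_isDiag]
    intro i j hij
    -- No single r needs to have distinct values: each off-diagonal entry is killed by an r that
    -- separates its own two indices.
    obtain ⟨r, hr, hrij⟩ := exists_equivariant_separating (F := F) w hij
    choose M hM using hN r hr
    have hM' : (Matrix.of M).map (algebraMap F (AlgebraicClosure F)) = N r := Matrix.ext hM
    have hcomm : (t : Matrix (Fin n) (Fin n) (AlgebraicClosure F)) * N r = N r * t := by
      ext a b
      have := h _ ⟨r, Matrix.of M, a, b, hr, hM', rfl⟩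
      rwa [hP, hM', sub_eq_zero] at this
    have h5 : ((g.1⁻¹ * t * g.1 : GL (Fin n) (AlgebraicClosure F)) :
        Matrix (Fin n) (Fin n) (AlgebraicClosure F)) * Matrix.diagonal r =
        Matrix.diagonal r * ((g.1⁻¹ * t * g.1 : GL (Fin n) (AlgebraicClosure F)) :
        Matrix (Fin n) (Fin n) (AlgebraicClosure F)) := by
      have hgN : ((g.1⁻¹ : GL (Fin n) (AlgebraicClosure F)) :
          Matrix (Fin n) (Fin n) (AlgebraicClosure F)) * N r = Matrix.diagonal r *
          ((g.1⁻¹ : GL (Fin n) (AlgebraicClosure F)) :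
            Matrix (Fin n) (Fin n) (AlgebraicClosure F)) := by
        simp only [N]
        rw [← Matrix.mul_assoc, ← Matrix.mul_assoc, hinv, Matrix.one_mul]
      rw [Units.val_mul, Units.val_mul, Matrix.mul_assoc, ← hNg, ← Matrix.mul_assoc,
        Matrix.mul_assoc _ _ (N r), hcomm, ← Matrix.mul_assoc, hgN, Matrix.mul_assoc,
        Matrix.mul_assoc, Matrix.mul_assoc]
    have h6 := congrFun (congrFun h5 i) j
    rw [Matrix.mul_diagonal, Matrix.diagonal_mul, mul_comm] at h6
    by_contra hne
    exact hrij (mul_right_cancel₀ hne h6).symm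

/-- The labelled frames whose lines are permuted by Frobenius according to `w`. -/
def FrobFrames (F : Type*) [Field F] [Fintype F] (w : Equiv.Perm (Fin n)) : Type _ :=
  {L : Fin n → Submodule (AlgebraicClosure F) (Fin n → AlgebraicClosure F) //
    IsFrame L ∧ ∀ i, frobeniusImage (Fintype.card F) (L i) = L (w i)}

/-- Around an orbit of length l the twisted equations collapse to x = x^(q^l) C, that is x^(q^l - 1)
= C⁻¹, which is solvable in the closure. -/
theorem skewMap_iterate_pow_mul (w : Equiv.Perm (Fin n)) {M : Type*} [CommMonoid M] (m : ℕ)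
    (c : Fin n → M) (i : Fin n) (k : ℕ) :
    ∃ C : M, ∀ x, ((skewMap w fun i (y : M) => y ^ m * c i)^[k] (i, x)).2 = x ^ m ^ k * C := by
  induction k with
  | zero => exact ⟨1, fun x => by simp⟩
  | succ k ih =>
    obtain ⟨C, hC⟩ := ih
    refine ⟨C ^ m * c (w^[k] i), fun x => ?_⟩
    rw [Function.iterate_succ_apply', skewMap, hC, skewMap_iterate_fst, mul_pow, ← pow_mul,
      ← pow_succ, mul_assoc]

/-- Lang's theorem for a torus twisted by a permutation of the coordinates. -/
theorem exists_units_twisted (w : Equiv.Perm (Fin n)) (c : Fin n → (AlgebraicClosure F)ˣ) :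
    ∃ r : Fin n → (AlgebraicClosure F)ˣ, ∀ i, r (w i) = r i ^ Fintype.card F * c i := by
  have h : ∀ o : Orbits w, ∃ x : (AlgebraicClosure F)ˣ,
      orbitMap w (fun i y => y ^ Fintype.card F * c i) o x = x := by
    intro o
    obtain ⟨C, hC⟩ := skewMap_iterate_pow_mul w (Fintype.card F) c o.out (orbitLength o)
    have hpos := one_lt_card_pow (F := F) (orbitLength_pos o)
    obtain ⟨x, hx⟩ := IsAlgClosed.exists_pow_nat_eq ((C⁻¹ : (AlgebraicClosure F)ˣ) :
      AlgebraicClosure F) (Nat.sub_pos_of_lt hpos)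
    have hx0 : x ≠ 0 := by
      rintro rfl
      rw [zero_pow (Nat.sub_pos_of_lt hpos).ne'] at hx
      exact C⁻¹.ne_zero hx.symm
    refine ⟨Units.mk0 x hx0, ?_⟩
    have hx' : (Units.mk0 x hx0) ^ (Fintype.card F ^ orbitLength o - 1) = C⁻¹ :=
      Units.ext (by simpa using hx)
    rw [orbitMap, hC]
    conv_lhs => rw [← Nat.sub_add_cancel hpos.le, pow_succ, hx']
    rw [mul_comm, mul_inv_cancel_left]
  choose x hx using h
  obtain ⟨r, hr, -⟩ := exists_equivariant x hx
  exact ⟨r, hr⟩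

theorem mul_diagGL_apply {K : Type*} [Field K] (g : GL (Fin n) K) (d : Fin n → Kˣ)
    (a i : Fin n) : (g * diagGL n K d : GL (Fin n) K) a i = g a i * d i := by
  rw [Units.val_mul, coe_diagGL, Matrix.mul_diagonal]

theorem frameLine_mul_diagGL {K : Type*} [Field K] (g : GL (Fin n) K) (d : Fin n → Kˣ) :
    frameLine (g * diagGL n K d) = frameLine g := by
  funext i
  have : (fun a => (g * diagGL n K d : GL (Fin n) K) a i) = (d i : K) • fun a => g a i := by
    funext a
    rw [mul_diagGL_apply, Pi.smul_apply, smul_eq_mul, mul_comm]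
  rw [frameLine, this, frameLine]
  exact Submodule.span_singleton_smul_eq (d i).isUnit _

theorem exists_diagGL_of_frameLine_eq {K : Type*} [Field K] {g h : GL (Fin n) K}
    (hgh : frameLine g = frameLine h) : ∃ d, g = h * diagGL n K d := by
  have h1 : ∀ i, ∃ c : Kˣ, (c : K) • (fun a => h a i) = fun a => g a i := by
    intro i
    have : (fun a => g a i) ∈ frameLine h i := by
      rw [← hgh]; exact Submodule.mem_span_singleton_self _
    obtain ⟨c, hc⟩ := Submodule.mem_span_singleton.1 this
    have hc0 : c ≠ 0 := by
      rintro rfl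
      rw [zero_smul] at hc
      exact column_ne_zero g i hc.symm
    exact ⟨Units.mk0 c hc0, hc⟩
  choose d hd using h1
  refine ⟨d, Units.ext (Matrix.ext fun a i => ?_)⟩
  rw [mul_diagGL_apply, ← congrFun (hd i) a, Pi.smul_apply, smul_eq_mul, mul_comm]

theorem frameLine_frobBases {w : Equiv.Perm (Fin n)} (g : FrobBases F w) (i : Fin n) :
    frobeniusImage (Fintype.card F) (frameLine g.1 i) = frameLine g.1 (w i) := by
  rw [frobeniusImage_frameLine, frameLine, frameLine]
  congr 2
  funext a
  exact g.2 a i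

/-- For any basis of the lines, Frob(g_i) = c_i g_{w(i)} with scalars c_i. Rescaling g_i by r_i
removes them when r_{w(i)} = r_i^q c_i. -/
theorem exists_frobBases {w : Equiv.Perm (Fin n)} (L : FrobFrames F w) :
    ∃ g : FrobBases F w, frameLine g.1 = L.1 := by
  obtain ⟨L, ⟨g, rfl⟩, hL⟩ := L
  have h1 : ∀ i, ∃ c : (AlgebraicClosure F)ˣ, ∀ a, frob F (g a i) = c * g a (w i) := by
    intro i
    have h2 : (fun a => frobGL F n g a i) ∈ frameLine g (w i) := by
      rw [← hL i, frobeniusImage_frameLine]; exact Submodule.mem_span_singleton_self _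
    obtain ⟨c, hc⟩ := Submodule.mem_span_singleton.1 h2
    have hc0 : c ≠ 0 := by
      rintro rfl
      rw [zero_smul] at hc
      exact column_ne_zero (frobGL F n g) i hc.symm
    exact ⟨Units.mk0 c hc0, fun a => (congrFun hc a).symm⟩
  choose c hc using h1
  obtain ⟨r, hr⟩ := exists_units_twisted w c
  refine ⟨⟨g * diagGL n _ r, fun a i => ?_⟩, frameLine_mul_diagGL g r⟩
  rw [mul_diagGL_apply, mul_diagGL_apply, map_mul, hc, hr, frob_apply (r i : AlgebraicClosure F),
    Units.val_mul, Units.val_pow_eq_pow_val]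
  ring

/-- A Frobenius-permuted basis amounts to a Frobenius-permuted frame and compatible scalars. -/
theorem card_frobFrames_mul (w : Equiv.Perm (Fin n)) :
    Nat.card (FrobFrames F w) * ∏ c : Orbits w, (Fintype.card F ^ orbitLength c - 1) =
      Nat.card (GL (Fin n) F) := by
  rw [← card_equivariant_units, ← card_frobBases w, ← Nat.card_prod]
  choose G hG using exists_frobBases (F := F) (w := w)
  have hmem : ∀ (L : FrobFrames F w)
      (d : {d : Fin n → (AlgebraicClosure F)ˣ // ∀ i, d (w i) = d i ^ Fintype.card F}) (a i : Fin n),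
      frob F (((G L).1 * diagGL n _ d.1 : GL (Fin n) (AlgebraicClosure F)) a i) =
        ((G L).1 * diagGL n _ d.1 : GL (Fin n) (AlgebraicClosure F)) a (w i) := by
    intro L d a i
    rw [mul_diagGL_apply, mul_diagGL_apply, map_mul, (G L).2, d.2,
      frob_apply (d.1 i : AlgebraicClosure F), Units.val_pow_eq_pow_val]
  refine Nat.card_congr (Equiv.ofBijective
    (fun p => (⟨(G p.1).1 * diagGL n _ p.2.1, hmem p.1 p.2⟩ : FrobBases F w)) ⟨?_, ?_⟩)
  · rintro ⟨L, d⟩ ⟨L', d'⟩ h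
    have h1 : (G L).1 * diagGL n _ d.1 = (G L').1 * diagGL n _ d'.1 := Subtype.ext_iff.1 h
    have hL : L = L' := Subtype.ext (by
      rw [← hG, ← hG, ← frameLine_mul_diagGL (G L).1 d.1, h1, frameLine_mul_diagGL])
    subst hL
    refine Prod.ext rfl (Subtype.ext (funext fun i => Units.ext ?_))
    have h2 := congrArg (fun g : GL (Fin n) (AlgebraicClosure F) =>
      (g : Matrix (Fin n) (Fin n) (AlgebraicClosure F)) i i) (mul_left_cancel h1)
    simpa [coe_diagGL] using h2
  · intro g
    let L : FrobFrames F w := ⟨frameLine g.1, ⟨g.1, rfl⟩, frameLine_frobBases g⟩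
    obtain ⟨d, hd⟩ := exists_diagGL_of_frameLine_eq (hG L).symm
    refine ⟨(L, ⟨d, fun i => Units.ext ?_⟩), Subtype.ext hd.symm⟩
    -- A nonzero entry of the column allows cancellation, leaving the compatibility condition on the
    -- scalars.
    obtain ⟨a, ha⟩ : ∃ a, (G L).1 a (w i) ≠ 0 := by
      by_contra h
      push Not at h
      exact column_ne_zero (G L).1 (w i) (funext h)
    have h1 := g.2 a i
    rw [hd, mul_diagGL_apply, mul_diagGL_apply, map_mul, (G L).2] at h1
    exact (mul_left_cancel₀ ha h1).symm

theorem finite_frobFrames (w : Equiv.Perm (Fin n)) : Finite (FrobFrames F w) := by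
  choose G hG using exists_frobBases (F := F) (w := w)
  exact Finite.of_injective G fun L L' h => Subtype.ext (by rw [← hG, ← hG, h])

/-! ### Tori and labelled frames -/

theorem exists_maxTori {w : Equiv.Perm (Fin n)} (L : FrobFrames F w) :
    ∃ T : MaxTori n F, eigenlines T.1 = Set.range L.1 := by
  obtain ⟨g, hg⟩ := exists_frobBases L
  refine ⟨⟨frameTorus g.1, isMaximalTorus_iff.2 ⟨g.1, rfl⟩, isDefinedOver_frameTorus g⟩, ?_⟩
  rw [eigenlines_frameTorus, hg]

instance finite_maxTori : Finite (MaxTori n F) := by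
  have := fun w : Equiv.Perm (Fin n) => finite_frobFrames (F := F) w
  have h : ∀ T : MaxTori n F, ∃ y : Σ w : Equiv.Perm (Fin n), FrobFrames F w,
      Set.range y.2.1 = eigenlines T.1 := by
    intro T
    obtain ⟨σ, L, hL, hr, hσ⟩ := exists_isFrobeniusPermutation T.2.1 T.2.2
    exact ⟨⟨σ, L, isFrame_of_eigenlines hL hr, hσ⟩, hr⟩
  choose y hy using h
  exact Finite.of_injective y fun T T' h => maxTori_ext (by rw [← hy, ← hy, h])

/-- Pairs (T, τ) of a torus and a relabelling τ correspond bijectively to all permuted frames. The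
frame L_T ∘ τ is permuted by τ⁻¹ σ_T τ, on which the class function takes the value χ(σ_T). -/
theorem sum_frobFrames {k : Type*} [Field k] [Fintype (MaxTori n F)]
    (χ : Equiv.Perm (Fin n) → k) (hχ : ∀ σ τ : Equiv.Perm (Fin n), χ (τ * σ * τ⁻¹) = χ σ)
    (s : MaxTori n F → Equiv.Perm (Fin n))
    (hs : ∀ T, IsFrobeniusPermutation (Fintype.card F) T.1 (s T)) :
    ∑ w, χ w * Nat.card (FrobFrames F w) = n.factorial * ∑ T, χ (s T) := by
  have := fun w : Equiv.Perm (Fin n) => finite_frobFrames (F := F) w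
  have := fun w : Equiv.Perm (Fin n) => Fintype.ofFinite (FrobFrames F w)
  choose L hL hr hσ using hs
  have hframe : ∀ (T : MaxTori n F) (τ : Equiv.Perm (Fin n)), IsFrame (L T ∘ τ) ∧
      ∀ i, frobeniusImage (Fintype.card F) ((L T ∘ τ) i) =
        (L T ∘ τ) ((τ⁻¹ * s T * τ : Equiv.Perm (Fin n)) i) := fun T τ =>
    ⟨isFrame_of_eigenlines (T := T) ((hL T).comp τ.injective)
      (by rw [τ.surjective.range_comp, hr]), fun i => by simp [hσ]⟩
  let Ψ : MaxTori n F × Equiv.Perm (Fin n) → Σ w : Equiv.Perm (Fin n), FrobFrames F w := fun p =>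
    ⟨p.2⁻¹ * s p.1 * p.2, L p.1 ∘ p.2, hframe p.1 p.2⟩
  have hΨ : Function.Bijective Ψ := by
    constructor
    · rintro ⟨T, τ⟩ ⟨T', τ'⟩ h
      have h1 : L T ∘ τ = L T' ∘ τ' :=
        congrArg (fun y : Σ w : Equiv.Perm (Fin n), FrobFrames F w => y.2.1) h
      have h2 : T = T' := maxTori_ext (by
        rw [← hr, ← hr, ← τ.surjective.range_comp, h1, τ'.surjective.range_comp])
      subst h2
      exact Prod.ext rfl (Equiv.ext fun i => hL T (congrFun h1 i))
    · rintro ⟨w, M⟩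
      obtain ⟨T, hT⟩ := exists_maxTori M
      have hM : Function.Injective M.1 := by
        obtain ⟨g, hg⟩ := M.2.1
        rw [← hg]; exact frameLine_injective g
      have h1 : ∀ i, ∃ j, L T j = M.1 i := fun i => by
        have : M.1 i ∈ Set.range (L T) := by rw [hr, hT]; exact ⟨i, rfl⟩
        exact this
      choose τ hτ using h1
      have hinj : Function.Injective τ := fun i j hij => hM (by rw [← hτ, ← hτ, hij])
      let e : Equiv.Perm (Fin n) := Equiv.ofBijective τ (Finite.injective_iff_bijective.1 hinj)
      have he : L T ∘ e = M.1 := funext hτ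
      have hw : e⁻¹ * s T * e = w := by
        refine Equiv.ext fun i => ?_
        have h2 := M.2.2 i
        rw [← he, Function.comp_apply, hσ, Function.comp_apply] at h2
        have h3 := hL T h2
        rw [Equiv.Perm.mul_apply, Equiv.Perm.mul_apply, h3, Equiv.Perm.inv_eq_iff_eq]
      refine ⟨(T, e), ?_⟩
      subst hw
      exact Sigma.ext rfl (heq_of_eq (Subtype.ext he))
  calc ∑ w, χ w * Nat.card (FrobFrames F w)
      = ∑ y : Σ w : Equiv.Perm (Fin n), FrobFrames F w, χ y.1 := by
        rw [Fintype.sum_sigma]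
        refine Finset.sum_congr rfl fun w _ => ?_
        dsimp only
        rw [Finset.sum_const, Finset.card_univ, nsmul_eq_mul, mul_comm, Nat.card_eq_fintype_card]
    _ = ∑ p : MaxTori n F × Equiv.Perm (Fin n), χ (s p.1) :=
        (Fintype.sum_bijective Ψ hΨ _ _ fun p => by
          have := hχ (s p.1) p.2⁻¹
          rw [inv_inv] at this
          exact this.symm).symm
    _ = n.factorial * ∑ T, χ (s T) := by
        rw [Fintype.sum_prod_type, Finset.mul_sum]
        refine Finset.sum_congr rfl fun T _ => ?_
        dsimp only
        rw [Finset.sum_const, Finset.card_univ, Fintype.card_perm, Fintype.card_fin, nsmul_eq_mul]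

end Rational

/-! ### The point count -/

section PointCount

variable {n : ℕ} {k : Type*} [Field k] [CharZero k]

/-- The graded character of the coinvariant algebra at `q⁻¹`. -/
theorem graded_character_eval (w : Equiv.Perm (Fin n)) (t : k) :
    (∑ a : Staircase n, (diagCoeff w a : k) * t ^ stairDegree a) *
      ∏ c : Orbits w, (1 - t ^ orbitLength c) = ∏ j : Fin n, (1 - t ^ ((j : ℕ) + 1)) := by
  have h := congrArg (Polynomial.eval₂ (Rat.castHom k) t) (graded_character_mul w)
  simpa [Polynomial.eval₂_mul, Polynomial.eval₂_finsetSum, Polynomial.eval₂_finsetProd] using h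

/-- Factoring out powers of q leaves ∏ (1 - q^(-j)) from the group order and ∏ (1 - q^(-|c|)) from
the orbits, which are the two sides of the graded character identity at t = 1/q. The orbit lengths
add up to n, whence the exponent n² - n. -/
theorem card_GL_eq_mul (F : Type*) [Field F] [Fintype F] (w : Equiv.Perm (Fin n)) :
    (Nat.card (GL (Fin n) F) : k) = (Fintype.card F : k) ^ ((n : ℤ) ^ 2 - n) *
      (∑ a : Staircase n, (diagCoeff w a : k) * ((Fintype.card F : k)⁻¹) ^ stairDegree a) *
      ∏ c : Orbits w, ((Fintype.card F ^ orbitLength c - 1 : ℕ) : k) := by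
  set q := Fintype.card F
  have hq0 : (q : k) ≠ 0 := Nat.cast_ne_zero.2 Fintype.card_ne_zero
  have h1 : ∏ c : Orbits w, ((q ^ orbitLength c - 1 : ℕ) : k) =
      (q : k) ^ n * ∏ c : Orbits w, (1 - ((q : k)⁻¹) ^ orbitLength c) := by
    have hn : (q : k) ^ n = (q : k) ^ ∑ c : Orbits w, orbitLength c := by
      rw [sum_orbitLength, Fintype.card_fin]
    rw [hn, ← Finset.prod_pow_eq_pow_sum, ← Finset.prod_mul_distrib]
    refine Finset.prod_congr rfl fun c _ => ?_
    rw [Nat.cast_sub (one_lt_card_pow (orbitLength_pos c)).le, mul_sub, mul_one, ← mul_pow,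
      mul_inv_cancel₀ hq0, one_pow, Nat.cast_pow, Nat.cast_one]
  have h2 : (Nat.card (GL (Fin n) F) : k) =
      (q : k) ^ (n * n) * ∏ j : Fin n, (1 - ((q : k)⁻¹) ^ ((j : ℕ) + 1)) := by
    have hconst : (q : k) ^ (n * n) = ∏ _j : Fin n, (q : k) ^ n := by
      rw [Finset.prod_const, Finset.card_univ, Fintype.card_fin, pow_mul]
    -- The factor q^n - q^i equals q^n (1 - q^(-(n-i))), so the indices are reversed to match j + 1
    -- = n - i.
    rw [Matrix.card_GL_field, Nat.cast_prod, hconst, ← Finset.prod_mul_distrib,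
      ← Equiv.prod_comp Fin.revPerm]
    refine Finset.prod_congr rfl fun j _ => ?_
    have hj : (q : k) ^ n = (q : k) ^ (((Fin.rev j : Fin n) : ℕ) + ((j : ℕ) + 1)) := by
      congr 1
      rw [Fin.val_rev]
      have := j.2
      omega
    rw [Fin.revPerm_apply, Nat.cast_sub (Nat.pow_le_pow_right Fintype.card_pos (Fin.rev j).2.le),
      Nat.cast_pow, Nat.cast_pow, mul_sub, mul_one]
    congr 1
    rw [hj, pow_add, mul_assoc, ← mul_pow, mul_inv_cancel₀ hq0, one_pow, mul_one]
  have h3 : (q : k) ^ (n * n) = (q : k) ^ ((n : ℤ) ^ 2 - n) * (q : k) ^ n := by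
    rw [← zpow_natCast, ← zpow_natCast, ← zpow_add₀ hq0]
    congr 1
    push_cast
    ring
  rw [h1, h2, ← graded_character_eval w, h3]
  ring

theorem finsum_innerChar (χ : Equiv.Perm (Fin n) → k) {q : k} (hq : q ≠ 0) :
    ∑ᶠ i : ℕ, q ^ ((n : ℤ) ^ 2 - n - i) * innerChar χ (coinvariantPartRep n i) =
      (n.factorial : k)⁻¹ * ∑ w, χ w * (q ^ ((n : ℤ) ^ 2 - n) *
        ∑ a : Staircase n, (diagCoeff w a : k) * (q⁻¹) ^ stairDegree a) := by
  classical
  have hchar : ∀ i : ℕ, innerChar χ (coinvariantPartRep n i) = (n.factorial : k)⁻¹ *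
      ∑ w, χ w * ∑ a : Staircase n with stairDegree a = i, (diagCoeff w a : k) := by
    intro i
    rw [innerChar]
    congr 1
    refine Finset.sum_congr rfl fun w _ => ?_
    rw [character_coinvariantPartRep, Rat.cast_sum]
  rw [finsum_eq_sum_of_support_subset (s := Finset.univ.image (stairDegree (n := n)))]
  · simp only [hchar, Finset.mul_sum]
    rw [Finset.sum_comm]
    refine Finset.sum_congr rfl fun w _ => ?_
    rw [← Finset.sum_fiberwise_of_maps_to (s := Finset.univ) (g := stairDegree (n := n))
      fun a _ => Finset.mem_image_of_mem _ (Finset.mem_univ a)]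
    refine Finset.sum_congr rfl fun i _ => Finset.sum_congr rfl fun a ha => ?_
    rw [(Finset.mem_filter.1 ha).2, zpow_sub₀ hq, zpow_natCast, inv_pow]
    ring
  · intro i hi
    rw [Function.mem_support, hchar] at hi
    by_contra h
    refine hi ?_
    have : ∀ w, ∑ a : Staircase n with stairDegree a = i, (diagCoeff w a : k) = 0 := fun w => by
      rw [Finset.filter_false_of_mem, Finset.sum_empty]
      intro a _ ha
      exact h (Finset.mem_coe.2 (Finset.mem_image.2 ⟨a, Finset.mem_univ a, ha⟩))
    simp [this]

theorem finsum_maxTori (F : Type*) [Field F] [Fintype F] (χ : Equiv.Perm (Fin n) → k)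
    (hχ : ∀ σ τ : Equiv.Perm (Fin n), χ (τ * σ * τ⁻¹) = χ σ)
    (s : MaxTori n F → Equiv.Perm (Fin n))
    (hs : ∀ T, IsFrobeniusPermutation (Fintype.card F) T.1 (s T)) :
    ∑ᶠ T : MaxTori n F, χ (s T) = ∑ᶠ i : ℕ, (Fintype.card F : k) ^ ((n : ℤ) ^ 2 - n - i) *
      innerChar χ (coinvariantPartRep n i) := by
  have := Fintype.ofFinite (MaxTori n F)
  have hn : (n.factorial : k) ≠ 0 := Nat.cast_ne_zero.2 n.factorial_ne_zero
  rw [finsum_innerChar χ (Nat.cast_ne_zero.2 Fintype.card_ne_zero), finsum_eq_sum_of_fintype,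
    eq_inv_mul_iff_mul_eq₀ hn, ← sum_frobFrames χ hχ s hs]
  refine Finset.sum_congr rfl fun w _ => ?_
  congr 1
  have h1 := card_frobFrames_mul (F := F) w
  have h2 := card_GL_eq_mul (k := k) F w
  rw [← h1, Nat.cast_mul, Nat.cast_prod] at h2
  refine mul_right_cancel₀ (Finset.prod_ne_zero_iff.2 fun c _ => ?_) h2
  exact Nat.cast_ne_zero.2 (Nat.sub_pos_of_lt (one_lt_card_pow (orbitLength_pos c))).ne'

end PointCount

end

end MaximalTori

theorem mainTheorem4 (n : ℕ) (F : Type*) [Field F] [Fintype F] (k : Type*) [Field k] [CharZero k]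
    (χ : Equiv.Perm (Fin n) → k) (hχ : ∀ σ τ : Equiv.Perm (Fin n), χ (τ * σ * τ⁻¹) = χ σ) :
    Finite (MaximalTori.MaxTori n F) ∧
    {i : ℕ | MaximalTori.coinvariantPart n i ≠ ⊥}.Finite ∧
    (∀ T : MaximalTori.MaxTori n F, ∃ σ : Equiv.Perm (Fin n),
      MaximalTori.IsFrobeniusPermutation (Fintype.card F) T.1 σ) ∧
    ∀ s : MaximalTori.MaxTori n F → Equiv.Perm (Fin n),
      (∀ T, MaximalTori.IsFrobeniusPermutation (Fintype.card F) T.1 (s T)) →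
      ∑ᶠ T : MaximalTori.MaxTori n F, χ (s T) =
        ∑ᶠ i : ℕ, (Fintype.card F : k) ^ ((n : ℤ) ^ 2 - n - i) *
          MaximalTori.innerChar χ (MaximalTori.coinvariantPartRep n i) :=
  ⟨MaximalTori.finite_maxTori, MaximalTori.finite_coinvariantPart_ne_bot,
    fun T => MaximalTori.exists_isFrobeniusPermutation T.2.1 T.2.2,
    MaximalTori.finsum_maxTori F χ hχ⟩
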